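/- \textbf{Theorem (Sufficient conditions for system identification).} \emph{System.} Let $K_\tau\ge 1$, let $\tau_1,\dots,\tau_{K_\tau}$ be distinct delays, and for each $i$ let $K_{\nu,i}\ge 1$, let $\nu_{i1},\dots,\nu_{iK_{\nu,i}}$ be distinct real Doppler shifts and $\alpha_{i1},\dots,\alpha_{iK_{\nu,i}}\in\mathbb C\setminus\{0\}$. Put $K_{\nu,\max}=\max_i K_{\nu,i}$. Let $\mathcal W>0$ and $\mathcal T$ be real numbers (the two-sided bandwidth, in angular frequency, and the temporal support of the input signal) with $$\mathcal T\mathcal W\ \ge\ 8\pi K_\tau K_{\nu,\max},$$ and set $p=2K_\tau$, $T=2\pi p/\mathcal W=4\pi K_\tau/\mathcal W$ and $N=\lfloor \mathcal T/T\rfloor$ (so $N=\mathcal T/T=\mathcal{TW}/(4\pi K_\tau)$ if this is an integer). \emph{Probing.} For $f\in L_2(\mathbb R)$ let $F(\omega)=\int f(t)e^{-\mathrm j\omega t}\,dt$ be its Fourier transform. The input signal is $x(t)=\sum_{n=0}^{N-1}x_n\,g(t-nT)$ with $x_n\in\mathbb C$, $|x_n|>0$ for all $n$, and a unit-energy pulse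 $g\in L_2(\mathbb R)$; the receiver uses a low-pass filter with impulse response $s^*(-t)$, $s\in L_2(\mathbb R)$. The spectra $G$ and $S$ vanish a.e. outside $\mathcal F=[-\mathcal W/2,\mathcal W/2]$, and $|G|$, $|S|$ are essentially bounded above and bounded away from $0$ on $\mathcal F$. \emph{Assumptions.} There are real numbers $\tau_{\max},\nu_{\max}$ such that [A1] $(\tau_i,\nu_{ij})\in[0,\tau_{\max}]\times[-\nu_{\max}/2,\nu_{\max}/2]$ for all $i,j$; [A2] $\tau_{\max}<T$; [A3] the Doppler spread is small compared with the bandwidth, in the following sense: $\nu_{\max}T<1$, and the Doppler phase is treated as constant over each pulse, $e^{\mathrm j2\pi\nu_{ij}t}\approx e^{\mathrm j2\pi\nu_{ij}nT}$ on the echoes of the $n$-th pulse, so that the received signal is $$y(t)=\sum_{i=1}^{K_\tau}\sum_{n=0}^{N-1}a_i[n]\,g(t-\tau_i-nT),\qquad a_i[n]=\sum_{j=1}^{K_{\nu,i}}\alpha_{ij}x_n e^{\mathrm j2\pi\nu_{ij}nT}.$$ \emph{Procedure.} Here $A^\dagger$ is the Moore--Penrose pseudoinverse and $m'=m-p/2-1$.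 \begin{enumerate} \item Sample the filter output $\int y(u)s^*(u-t)\,du$ at the times $t=2\pi n/\mathcal W$, $n\in\mathbb Z$, and split the samples into $c_\ell[n]=\int y(u)\,s^*(u-nT-(\ell-1)T/p)\,du$, $1\le\ell\le p$. \item Form $\mathbf d[n]$ by applying to $\mathbf c[n]$ the digital filter bank with frequency response $\mathbf W(e^{\mathrm j\omega T})^{-1}$, $\omega\in[0,2\pi/T)$, where $\mathbf W_{\ell m}(e^{\mathrm j\omega T})=e^{\mathrm j\omega(\ell-1)T/p}\,\frac1T\,S^*(\omega+\frac{2\pi}Tm')\,G(\omega+\frac{2\pi}Tm')\,e^{\mathrm j\frac{2\pi}p(\ell-1)m'}$. \item (ESPRIT with smoothing.) Let $M=p/2$, $\mathbf d_m[n]=(d_m[n],\dots,d_{m+M}[n])^T$ and $\overline{\mathbf R}=\frac1M\sum_{m=1}^M\sum_{n\in\mathbb Z}\mathbf d_m[n]\mathbf d_m[n]^H$. Take $\widehat K_\tau=\operatorname{rank}\overline{\mathbf R}$, let $\mathbf E$ have as columns the left singular vectors for the nonzero singular values of $\overline{\mathbf R}$, let $\mathbf E_\downarrow,\mathbf E_\uparrow$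 be $\mathbf E$ without its last, respectively first, row, and let $\lambda_i$ be the eigenvalues of $\mathbf E_\downarrow^\dagger\mathbf E_\uparrow$. Put $\widehat\tau_i=-\frac T{2\pi}\arg\lambda_i\in[0,T)$. \item With $\mathbf N_{mi}=e^{-\mathrm j\frac{2\pi}Tm'\widehat\tau_i}$, recover $\widehat a_i[n]$ by applying to the $i$-th entry of $\mathbf N^\dagger\mathbf d[n]$ the filter with frequency response $e^{\mathrm j\omega\widehat\tau_i}$, $\omega\in[0,2\pi/T)$, and put $\tilde a_i[n]=\widehat a_i[n]/x_n$, $0\le n<N$. \item (Annihilating filter.) For each $i$ let $h_i$ be a monic polynomial of least degree $L$ with $\sum_{k=0}^{L}h_{i,k}\,\tilde a_i[n+k]=0$ for all $0\le n<N-L$. From its roots $z_{ij}$ put $\widehat\nu_{ij}=\frac1{2\pi T}\arg z_{ij}$, $\arg\in(-\pi,\pi]$, and $\widehat{\boldsymbol\alpha}_i=\mathbf R_i^\dagger\tilde{\mathbf a}_i$ with $(\mathbf R_i)_{nj}=e^{\mathrm j2\pi\widehat\nu_{ij}nT}$, $0\le n<N$. \end{enumerate} \emph{Conclusion.} The procedure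 can be carried out on $y$, and, however the singular vectors are chosen and the eigenvalues and roots are ordered, the triplets $(\widehat\tau_i,\widehat\nu_{ij},\widehat\alpha_{ij})$ that it returns are, up to relabelling, exactly the triplets $(\tau_i,\nu_{ij},\alpha_{ij})$; in particular $\widehat K_\tau=K_\tau$ and the numbers of Doppler shifts agree. Thus the system is identified uniquely from the single observation $y$. -/

import Mathlib

open MeasureTheory
open scoped FourierTransform Matrix Polynomial

/-- A finite list of delays `delay i`, and for each of them a finite list of Doppler shifts
`doppler i j` with attenuation factors `gain i j`: the triplets `(τ_i, ν_ij, α_ij)`. -/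
structure DelayDoppler where
  /-- `K_τ` -/
  numDelays : ℕ
  /-- `K_{ν,i}` -/
  numDopplers : Fin numDelays → ℕ
  /-- `τ_i` -/
  delay : Fin numDelays → ℝ
  /-- `ν_ij` -/
  doppler : (i : Fin numDelays) → Fin (numDopplers i) → ℝ
  /-- `α_ij` -/
  gain : (i : Fin numDelays) → Fin (numDopplers i) → ℂ

namespace DelayDoppler

/-- The triplets describe a parametric system completely and without redundancy: there is at
least one delay, the delays are distinct, every delay carries at least one Doppler shift, the
Doppler shifts of one delay are distinct, and no attenuation factor vanishes. -/
structure IsParametricSystem (H : DelayDoppler) : Prop where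
  numDelays_pos : 0 < H.numDelays
  delay_injective : Function.Injective H.delay
  numDopplers_pos : ∀ i, 0 < H.numDopplers i
  doppler_injective : ∀ i, Function.Injective (H.doppler i)
  gain_ne_zero : ∀ i j, H.gain i j ≠ 0

/-- `K_{ν,max}`, the largest number of Doppler shifts at one delay. -/
def maxDopplers (H : DelayDoppler) : ℕ := Finset.univ.sup H.numDopplers

/-- The response lies in the rectangle `[0, τmax] × [-νmax/2, νmax/2]`. -/
def LiesIn (H : DelayDoppler) (τmax νmax : ℝ) : Prop :=
  ∀ i, H.delay i ∈ Set.Icc 0 τmax ∧ ∀ j, H.doppler i j ∈ Set.Icc (-νmax / 2) (νmax / 2)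

/-- The two lists of triplets agree up to relabelling. -/
def SameTriplets (A B : DelayDoppler) : Prop :=
  ∃ e : Fin A.numDelays ≃ Fin B.numDelays, (∀ i, A.delay i = B.delay (e i)) ∧
    ∀ i, ∃ f : Fin (A.numDopplers i) ≃ Fin (B.numDopplers (e i)),
      ∀ j, A.doppler i j = B.doppler (e i) (f j) ∧ A.gain i j = B.gain (e i) (f j)

/-- `a_i[n] = ∑_j α_ij x_n e^{j 2π ν_ij n T}`. -/
noncomputable def coeffSeq (H : DelayDoppler) (T : ℝ) (x : ℕ → ℂ) (i : Fin H.numDelays)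
    (n : ℕ) : ℂ :=
  ∑ j, H.gain i j * x n * Complex.exp (2 * Real.pi * H.doppler i j * n * T * Complex.I)

/-- The output of the system probed with the pulse train `x(t) = ∑_{n<N} x_n g(t - nT)`, in the
narrowband model of a slowly varying system: the echo of the `n`-th pulse at delay `τ_i`
keeps the Doppler phase `e^{j 2π ν_ij n T}` that it has at time `nT`, so that
`y(t) = ∑_i ∑_{n<N} a_i[n] g(t - τ_i - nT)`. -/
noncomputable def output (H : DelayDoppler) (T : ℝ) (N : ℕ) (x : ℕ → ℂ) (g : ℝ → ℂ) (t : ℝ) : ℂ :=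
  ∑ i, ∑ n ∈ Finset.range N, H.coeffSeq T x i n * g (t - H.delay i - n * T)

end DelayDoppler

/-- The Fourier transform `F(ω) = ∫ f(t) e^{-jωt} dt` of a finite-energy signal in the
angular frequency `ω`. -/
noncomputable def angularFourier (f : Lp ℂ 2 (volume : Measure ℝ)) (ω : ℝ) : ℂ :=
  (𝓕 f : Lp ℂ 2 (volume : Measure ℝ)) (ω / (2 * Real.pi))

/-- `f` is band-limited to `[-W/2, W/2]` (two-sided bandwidth `W`), and its spectrum is bounded
above and bounded away from zero on that band. -/
def FillsBand (W : ℝ) (f : Lp ℂ 2 (volume : Measure ℝ)) : Prop :=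
  (∀ᵐ ω : ℝ, W / 2 < |ω| → angularFourier f ω = 0) ∧
    ∃ a b : ℝ, 0 < a ∧ ∀ᵐ ω : ℝ, |ω| ≤ W / 2 →
      a ≤ ‖angularFourier f ω‖ ∧ ‖angularFourier f ω‖ ≤ b

/-- The output at time `t` of the low-pass filter with impulse response `s*(-t)`. -/
noncomputable def lpfOutput (s y : ℝ → ℂ) (t : ℝ) : ℂ :=
  ∫ u, y u * (starRingEnd ℂ) (s (u - t))

/-- The subsequences `c_ℓ[n]` (with `ℓ = 0, …, p - 1`) of the samples of the filter output
at the times `2πn/W`, obtained by serial-to-parallel conversion. -/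
noncomputable def sampleSeq (W : ℝ) (p : ℕ) (s y : ℝ → ℂ) (l : Fin p) (n : ℤ) : ℂ :=
  lpfOutput s y (2 * (n * p + l) * Real.pi / W)

/-- The inverse DTFT of a function given on the period `[0, 2π/T)`. -/
noncomputable def idtft (T : ℝ) (F : ℝ → ℂ) (n : ℤ) : ℂ :=
  (T / (2 * Real.pi) : ℝ) *
    ∫ ω in (0 : ℝ)..(2 * Real.pi / T), F ω * Complex.exp (ω * n * T * Complex.I)

/-- Discrete convolution on `ℤ`. -/
noncomputable def seqConv (u v : ℤ → ℂ) (n : ℤ) : ℂ := ∑' k : ℤ, u (n - k) * v k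

/-- The `p × p` matrix `W(e^{jωT})` for `p = 2M` and `ω ∈ [0, 2π/T)`; rows and columns are
numbered from `0`, so that the shift is `m' = m - M`. -/
noncomputable def samplingMatrix (T : ℝ) (M : ℕ) (g s : Lp ℂ 2 (volume : Measure ℝ)) (ω : ℝ) :
    Matrix (Fin (2 * M)) (Fin (2 * M)) ℂ :=
  Matrix.of fun l m =>
    Complex.exp (ω * l * T / (2 * M) * Complex.I) * (1 / T) *
      (starRingEnd ℂ) (angularFourier s (ω + 2 * Real.pi / T * ((m : ℝ) - M))) *
      angularFourier g (ω + 2 * Real.pi / T * ((m : ℝ) - M)) *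
      Complex.exp (2 * Real.pi / (2 * M) * l * ((m : ℂ) - M) * Complex.I)

/-- The modified measurements `d_m[n]`: the sequences `c_ℓ` after the digital correction filter
bank with frequency response `W(e^{jωT})⁻¹`. -/
noncomputable def modifiedSeq (W T : ℝ) (M : ℕ) (g s : Lp ℂ 2 (volume : Measure ℝ)) (y : ℝ → ℂ)
    (m : Fin (2 * M)) (n : ℤ) : ℂ :=
  ∑ l, seqConv (idtft T fun ω => (samplingMatrix T M g s ω)⁻¹ m l)
    (sampleSeq W (2 * M) s y l) n

/-- The smoothed correlation matrix `(1/M) ∑_{m=1}^M ∑_n d_m[n] d_m[n]ᴴ`, where the subvector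
`d_m[n]` consists of the `M + 1` consecutive entries of `d[n]` that start at the `m`-th. -/
noncomputable def smoothedCorrelation (M : ℕ) (d : Fin (2 * M) → ℤ → ℂ) :
    Matrix (Fin (M + 1)) (Fin (M + 1)) ℂ :=
  Matrix.of fun k l => (1 / M : ℂ) * ∑ m : Fin M, ∑' n : ℤ,
    d ⟨m + k, by omega⟩ n * (starRingEnd ℂ) (d ⟨m + l, by omega⟩ n)

/-- `R = E Σ Vᴴ` is a compact singular value decomposition: the columns of `E` are left singular
vectors for the nonzero singular values `σ` of `R`. -/
def IsCompactSVD {m r : ℕ} (R : Matrix (Fin m) (Fin m) ℂ) (E : Matrix (Fin m) (Fin r) ℂ)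
    (σ : Fin r → ℝ) (V : Matrix (Fin m) (Fin r) ℂ) : Prop :=
  (∀ i, 0 < σ i) ∧ Eᴴ * E = 1 ∧ Vᴴ * V = 1 ∧
    R = E * Matrix.diagonal (fun i => (σ i : ℂ)) * Vᴴ

/-- The four Penrose conditions. -/
def IsMoorePenroseInverse {m n : ℕ} (A : Matrix (Fin m) (Fin n) ℂ)
    (B : Matrix (Fin n) (Fin m) ℂ) : Prop :=
  A * B * A = A ∧ B * A * B = B ∧ (A * B)ᴴ = A * B ∧ (B * A)ᴴ = B * A

/-- The Moore-Penrose pseudoinverse. -/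
noncomputable def pinv {m n : ℕ} (A : Matrix (Fin m) (Fin n) ℂ) : Matrix (Fin n) (Fin m) ℂ :=
  Classical.epsilon (IsMoorePenroseInverse A)

/-- The matrix `E_{s↓}^† E_{s↑}`; the arrows `↓`, `↑` remove the last and the first row. -/
noncomputable def rotationMatrix {M r : ℕ} (E : Matrix (Fin (M + 1)) (Fin r) ℂ) :
    Matrix (Fin r) (Fin r) ℂ :=
  pinv (E.submatrix Fin.castSucc id) * E.submatrix Fin.succ id

/-- The `p × K_τ` Vandermonde matrix `N(τ)`, `p = 2M`, with entries `e^{-j (2π/T) m' τ_i}`. -/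
noncomputable def delayMatrix (T : ℝ) (M : ℕ) {r : ℕ} (τ : Fin r → ℝ) :
    Matrix (Fin (2 * M)) (Fin r) ℂ :=
  Matrix.of fun m i => Complex.exp (-(2 * Real.pi / T * ((m : ℂ) - M) * τ i) * Complex.I)

/-- The sequences `a_i[n]` recovered from `d[n]` and the delays: `b[n] = N(τ)^† d[n]`, followed by
the filters with frequency response `D(e^{jωT}, τ)⁻¹`, that is `e^{jωτ_i}` for
`ω ∈ [0, 2π/T)`. -/
noncomputable def recoveredSeq (T : ℝ) (M : ℕ) (d : Fin (2 * M) → ℤ → ℂ) {r : ℕ} (τ : Fin r → ℝ)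
    (i : Fin r) (n : ℤ) : ℂ :=
  seqConv (idtft T fun ω => Complex.exp (ω * τ i * Complex.I))
    (fun k => (pinv (delayMatrix T M τ) *ᵥ fun m => d m k) i) n

/-- The `N × K` Vandermonde matrix `R(ν)` with entries `e^{j 2π ν_j n T}`. -/
noncomputable def dopplerMatrix (T : ℝ) (N : ℕ) {K : ℕ} (ν : Fin K → ℝ) :
    Matrix (Fin N) (Fin K) ℂ :=
  Matrix.of fun n j => Complex.exp (2 * Real.pi * ν j * n * T * Complex.I)

/-- `h`, normalized to be monic, is an annihilating filter of `u[0], …, u[N-1]`: every complete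
window of the convolution of `u` with the coefficients of `h` vanishes. -/
def IsAnnihilatingFilter (N : ℕ) (u : ℕ → ℂ) (h : ℂ[X]) : Prop :=
  h.Monic ∧ ∀ n, n + h.natDegree < N →
    ∑ k ∈ Finset.range (h.natDegree + 1), h.coeff k * u (n + k) = 0

/-- An annihilating filter of the smallest possible order. -/
def IsMinimalAnnihilatingFilter (N : ℕ) (u : ℕ → ℂ) (h : ℂ[X]) : Prop :=
  IsAnnihilatingFilter N u h ∧ ∀ h', IsAnnihilatingFilter N u h' → h.natDegree ≤ h'.natDegree

/-- A run of the recovery procedure on the received signal `y`, with `p = 2M` sampling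
subsequences. The procedure uses the pulse `g`, the filter kernel `s`, the pulse period `T`,
the bandwidth `W`, the probing sequence `x_0, …, x_{N-1}` and the number `M`, but no parameters
of the system. The fields leave open only what the procedure leaves open: the choice
of the singular vectors, and the order in which eigenvalues and roots are listed. -/
structure RecoveryRun (W T : ℝ) (M N : ℕ) (g s : Lp ℂ 2 (volume : Measure ℝ)) (x : ℕ → ℂ)
    (y : ℝ → ℂ) where
  /-- The triplets that the run returns. -/
  estimate : DelayDoppler
  /-- The number of delays is the rank of the smoothed correlation matrix. -/
  numDelays_eq : estimate.numDelays =
    (smoothedCorrelation M (modifiedSeq W T M g s y)).rank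
  /-- `E_s` -/
  leftVec : Matrix (Fin (M + 1)) (Fin estimate.numDelays) ℂ
  /-- The nonzero singular values. -/
  singularValue : Fin estimate.numDelays → ℝ
  /-- The right singular vectors. -/
  rightVec : Matrix (Fin (M + 1)) (Fin estimate.numDelays) ℂ
  svd : IsCompactSVD (smoothedCorrelation M (modifiedSeq W T M g s y))
    leftVec singularValue rightVec
  /-- The eigenvalues `λ_i` of `E_{s↓}^† E_{s↑}`, with multiplicity. -/
  eigenvalue : Fin estimate.numDelays → ℂ
  eigenvalue_eq : (rotationMatrix leftVec).charpoly.roots = Finset.univ.val.map eigenvalue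
  /-- `τ_i = -(T/2π) arg λ_i`, with the branch of the argument for which `τ_i ∈ [0, T)`. -/
  delay_eq : ∀ i, estimate.delay i =
    T * Int.fract (-(eigenvalue i).arg / (2 * Real.pi))
  /-- The filter that annihilates `a_i[n] / x_n`, `0 ≤ n < N`. -/
  filter : Fin estimate.numDelays → ℂ[X]
  filter_minimal : ∀ i, IsMinimalAnnihilatingFilter N
    (fun n => recoveredSeq T M (modifiedSeq W T M g s y) estimate.delay i n / x n) (filter i)
  /-- The roots `e^{j 2π ν_ij T}` of the annihilating filter, with multiplicity. -/
  root : (i : Fin estimate.numDelays) → Fin (estimate.numDopplers i) → ℂ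
  root_eq : ∀ i, (filter i).roots = Finset.univ.val.map (root i)
  doppler_eq : ∀ i j, estimate.doppler i j = (root i j).arg / (2 * Real.pi * T)
  /-- `α_i = R(ν_i)^† ã_i` with `ã_i[n] = a_i[n] / x_n`. -/
  gain_eq : ∀ i, estimate.gain i = pinv (dopplerMatrix T N (estimate.doppler i)) *ᵥ
    fun n : Fin N =>
      recoveredSeq T M (modifiedSeq W T M g s y) estimate.delay i (n : ℕ) / x n

/-! The proof reduces the measurements exactly to finite sums of exponentials, and then uses
nonsingularity of Vandermonde matrices again and again.

Analytic half. By Plancherel, each sample of the filter output is an integral of `G S*` against an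
exponential. The band consists of exactly `p = 2K_τ` periods of length `2π/T`, so folding it onto
one period writes the vector of sample sequences as the inverse DTFT of `W(ω) N(τ)` applied to the
vector of functions `e^{-jωτ_i} A_i` (`lpf_echo_eq_idtft`). For almost every `ω`, `W(ω)` is a
product of diagonal matrices and a DFT matrix. The spectra are bounded above and away from zero, so
`W` and `W⁻¹` are essentially bounded, and the convolution theorem applies to the correction
filters. What remains is `d[n] = N(τ) b[n]`, where `b_i` is `a_i` delayed by `τ_i`
(`modifiedSeq_eq_sum`).

Delays. As `0 ≤ τ_i < T`, the nodes `z_i = e^{-j2πτ_i/T}` are distinct. The smoothed correlation is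
`V P Vᴴ` with `V` the Vandermonde matrix of the nodes and `P` positive definite
(`smoothedCorrelation_factor`). Its rank is therefore `K_τ`, and any choice of `E` spans the column
space of `V`. Shift invariance of that space makes the rotation matrix similar to `diag(z_i)`
(`roots_charpoly_rotationMatrix`).

Dopplers and gains. `N(τ)^†` and the fractional advances return `a_i`, and `a_i[n]/x_n` is a sum of
`K_{ν,i}` exponentials. The time-bandwidth condition says `N ≥ 2K_{ν,max}`, which is what forces the
minimal annihilating filter to have precisely these exponentials as roots
(`IsMinimalAnnihilatingFilter.eq_prod`). Since `|ν_ij| T < 1/2`, the argument of a root determines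
the Doppler shift, and the gains solve an injective linear system.

The true triplets constitute a run, which gives existence. The same identities force every run to
agree with them up to order. -/

/-! ### Translation, modulation and Plancherel in `L²` -/

/-- Translation of a finite-energy signal by `a`. -/
noncomputable def translateLp (a : ℝ) :
    Lp ℂ 2 (volume : Measure ℝ) →ₗᵢ[ℂ] Lp ℂ 2 (volume : Measure ℝ) :=
  Lp.compMeasurePreservingₗᵢ ℂ (fun u : ℝ => u - a) (measurePreserving_sub_right volume a)

theorem translateLp_ae (a : ℝ) (f : Lp ℂ 2 (volume : Measure ℝ)) :
    translateLp a f =ᵐ[volume] fun u => f (u - a) :=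
  Lp.coeFn_compMeasurePreserving f (measurePreserving_sub_right volume a)

theorem memLp_top_character (a : ℝ) :
    MemLp (fun ξ : ℝ => Complex.exp (-(2 * Real.pi * ξ * a) * Complex.I)) ⊤
      (volume : Measure ℝ) := by
  refine memLp_top_of_bound (by fun_prop) 1 (.of_forall fun ξ => le_of_eq ?_)
  have := Complex.norm_exp_ofReal_mul_I (-(2 * Real.pi * ξ * a))
  push_cast at this
  exact this

/-- Multiplication of a spectrum by the character `ξ ↦ e^{-2πiξa}`. -/
noncomputable def modulateLp (a : ℝ) :
    Lp ℂ 2 (volume : Measure ℝ) →L[ℂ] Lp ℂ 2 (volume : Measure ℝ) :=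
  (ContinuousLinearMap.lsmul ℂ ℂ).holderL volume ⊤ 2 2 ((memLp_top_character a).toLp _)

theorem modulateLp_ae (a : ℝ) (f : Lp ℂ 2 (volume : Measure ℝ)) :
    modulateLp a f =ᵐ[volume]
      fun ξ => Complex.exp (-(2 * Real.pi * ξ * a) * Complex.I) * f ξ := by
  have h := (ContinuousLinearMap.lsmul ℂ ℂ).coeFn_holder (r := 2)
    ((memLp_top_character a).toLp _) f
  filter_upwards [h, (memLp_top_character a).coeFn_toLp] with ξ h1 h2
  rw [h2] at h1
  exact h1

/-- Both sides are continuous in `f`, so the classical shift rule for Schwartz functions extends by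
density. -/
theorem fourier_translateLp (a : ℝ) (f : Lp ℂ 2 (volume : Measure ℝ)) :
    𝓕 (translateLp a f) = modulateLp a (𝓕 f) := by
  refine DenseRange.induction_on
    (p := fun f : Lp ℂ 2 (volume : Measure ℝ) => 𝓕 (translateLp a f) = modulateLp a (𝓕 f))
    (SchwartzMap.denseRange_toLpCLM (p := 2) (E := ℝ) (F := ℂ) (μ := volume)
      ENNReal.ofNat_ne_top) f ?_ ?_
  · refine isClosed_eq ?_ ?_
    · exact (FourierTransform.fourierCLM ℂ (Lp ℂ 2 (volume : Measure ℝ))).continuous.comp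
        (translateLp a).continuous
    · exact (modulateLp a).continuous.comp
        (FourierTransform.fourierCLM ℂ (Lp ℂ 2 (volume : Measure ℝ))).continuous
  · intro φ
    have hshift : translateLp a (φ.toLp 2) = (φ.compSubConstCLM ℂ a).toLp 2 := by
      refine Lp.ext ?_
      have h1 := (measurePreserving_sub_right (volume : Measure ℝ) a).quasiMeasurePreserving.ae
        (φ.coeFn_toLp 2 volume)
      filter_upwards [translateLp_ae a (φ.toLp 2), h1,
        (φ.compSubConstCLM ℂ a).coeFn_toLp 2 volume] with u h1 h2 h3
      rw [h1, h2, h3, SchwartzMap.compSubConstCLM_apply]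
    change 𝓕 (translateLp a (φ.toLp 2)) = modulateLp a (𝓕 (φ.toLp 2))
    rw [hshift, SchwartzMap.toLp_fourier_eq, SchwartzMap.toLp_fourier_eq]
    refine Lp.ext ?_
    filter_upwards [modulateLp_ae a ((𝓕 φ).toLp 2), (𝓕 φ).coeFn_toLp 2 volume,
        (𝓕 (φ.compSubConstCLM ℂ a)).coeFn_toLp 2 volume] with ξ h1 h2 h3
    rw [h1, h2, h3, SchwartzMap.fourier_coe, SchwartzMap.fourier_coe]
    have h := congrFun (VectorFourier.fourierIntegral_comp_add_right Real.fourierChar volume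
      (innerₗ ℝ) φ (-a)) ξ
    simp only [Function.comp_def, ← sub_eq_add_neg] at h
    change VectorFourier.fourierIntegral Real.fourierChar volume (innerₗ ℝ)
      (fun v => φ (v - a)) ξ = _ * VectorFourier.fourierIntegral Real.fourierChar volume
        (innerₗ ℝ) φ ξ
    rw [h, Circle.smul_def, smul_eq_mul, Real.fourierChar_apply]
    congr 2
    simp
    ring

/-- Plancherel's theorem for translates of finite-energy signals. -/
theorem integral_translate_mul_conj_translate (f s : Lp ℂ 2 (volume : Measure ℝ)) (a t : ℝ) :
    ∫ u, f (u - a) * (starRingEnd ℂ) (s (u - t)) =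
      ∫ ξ, 𝓕 f ξ * (starRingEnd ℂ) (𝓕 s ξ) *
        Complex.exp (2 * Real.pi * ξ * (t - a) * Complex.I) := by
  have h := Lp.inner_fourier_eq (translateLp t s) (translateLp a f)
  rw [L2.inner_def, L2.inner_def] at h
  calc _ = ∫ u, inner ℂ (translateLp t s u) (translateLp a f u) := by
        refine integral_congr_ae ?_
        filter_upwards [translateLp_ae t s, translateLp_ae a f] with u h1 h2
        rw [h1, h2, RCLike.inner_apply]
    _ = _ := h.symm
    _ = _ := by
        rw [fourier_translateLp, fourier_translateLp]
        refine integral_congr_ae ?_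
        filter_upwards [modulateLp_ae t (𝓕 s), modulateLp_ae a (𝓕 f)] with ξ h1 h2
        rw [h1, h2, RCLike.inner_apply, map_mul, ← Complex.exp_conj]
        have : Complex.exp (2 * Real.pi * ξ * (t - a) * Complex.I) =
          Complex.exp (-(2 * Real.pi * ξ * a) * Complex.I) *
          Complex.exp ((starRingEnd ℂ) (-(2 * Real.pi * ξ * t) * Complex.I)) := by
          rw [← Complex.exp_add]
          congr 1
          simp [Complex.conj_ofNat]
          ring
        rw [this]
        ring

theorem integrable_translate_mul_conj_translate (f s : Lp ℂ 2 (volume : Measure ℝ)) (a t : ℝ) :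
    Integrable fun u => f (u - a) * (starRingEnd ℂ) (s (u - t)) := by
  refine (L2.integrable_inner (𝕜 := ℂ) (translateLp t s) (translateLp a f)).congr ?_
  filter_upwards [translateLp_ae t s, translateLp_ae a f] with u h1 h2
  rw [h1, h2, RCLike.inner_apply]

/-! ### The inverse DTFT as Fourier series on the circle of length `2π/T` -/

/-- Fourier coefficients integrate against `e^{-jωnT}` and the inverse DTFT against `e^{jωnT}`;
hence the reversed index. -/
theorem fourierCoeff_liftIoc_eq_idtft {T : ℝ} (hT : 0 < T) [Fact (0 < 2 * Real.pi / T)]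
    (F : ℝ → ℂ) (n : ℤ) :
    fourierCoeff (AddCircle.liftIoc (2 * Real.pi / T) 0 F) n = idtft T F (-n) := by
  rw [fourierCoeff_liftIoc_eq, fourierCoeffOn_eq_integral, idtft]
  simp only [zero_add, sub_zero, one_div_div, Complex.real_smul]
  congr 1
  refine intervalIntegral.integral_congr fun ω _ => ?_
  simp only [fourier_coe_apply, smul_eq_mul]
  rw [mul_comm]
  congr 2
  have := Real.pi_ne_zero
  have hpi : (Real.pi : ℂ) ≠ 0 := by exact_mod_cast this
  have hT' : (T : ℂ) ≠ 0 := by exact_mod_cast hT.ne'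
  push_cast
  field_simp
  simp
  ring

/-- Parseval's identity for the inverse DTFT. -/
theorem hasSum_idtft_mul_conj {T : ℝ} (hT : 0 < T) {F G : ℝ → ℂ}
    (hF : MemLp F 2 (volume.restrict (Set.Ioc 0 (2 * Real.pi / T))))
    (hG : MemLp G 2 (volume.restrict (Set.Ioc 0 (2 * Real.pi / T)))) :
    HasSum (fun n => idtft T F n * (starRingEnd ℂ) (idtft T G n))
      ((T / (2 * Real.pi) : ℝ) *
        ∫ ω in (0 : ℝ)..(2 * Real.pi / T), F ω * (starRingEnd ℂ) (G ω)) := by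
  have hP : Fact (0 < 2 * Real.pi / T) := ⟨by positivity⟩
  set P := 2 * Real.pi / T with hPdef
  rw [← zero_add P] at hF hG
  have hF' := hF.memLp_liftIoc.haarAddCircle
  have hG' := hG.memLp_liftIoc.haarAddCircle
  have h := (@fourierBasis P hP).hasSum_inner_mul_inner (hG'.toLp _) (hF'.toLp _)
  have hcoef : ∀ {F : ℝ → ℂ} (hF : MemLp (AddCircle.liftIoc P 0 F) 2 AddCircle.haarAddCircle)
      (n : ℤ), inner ℂ (fourierBasis n) (hF.toLp _) = idtft T F (-n) := by
    intro F hF n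
    rw [← HilbertBasis.repr_apply_apply, fourierBasis_repr, fourierCoeff_congr_ae hF.coeFn_toLp,
      fourierCoeff_liftIoc_eq_idtft hT]
  have hterm : (fun n => idtft T F n * (starRingEnd ℂ) (idtft T G n)) ∘ (Equiv.neg ℤ) = fun n =>
      inner ℂ (hG'.toLp _) (fourierBasis n) * inner ℂ (fourierBasis n) (hF'.toLp _) := by
    funext n
    rw [← inner_conj_symm (hG'.toLp _), hcoef hF', hcoef hG', mul_comm]
    rfl
  have hval : inner ℂ (hG'.toLp _) (hF'.toLp _) =
      (T / (2 * Real.pi) : ℝ) * ∫ ω in (0 : ℝ)..P, F ω * (starRingEnd ℂ) (G ω) := by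
    rw [L2.inner_def]
    have : ∫ a, inner ℂ ((hG'.toLp _) a) ((hF'.toLp _) a) ∂AddCircle.haarAddCircle =
        ∫ a, AddCircle.liftIoc P 0 (fun ω => F ω * (starRingEnd ℂ) (G ω)) a
          ∂AddCircle.haarAddCircle := by
      refine integral_congr_ae ?_
      filter_upwards [hF'.coeFn_toLp, hG'.coeFn_toLp] with a h1 h2
      rw [h1, h2, RCLike.inner_apply]
      rfl
    rw [this, AddCircle.integral_haarAddCircle, AddCircle.integral_liftIoc_eq_intervalIntegral,
      zero_add, Complex.real_smul, hPdef, inv_div]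
  rw [← (Equiv.neg ℤ).hasSum_iff, hterm, ← hval]
  exact h

theorem idtft_congr {T : ℝ} (hT : 0 < T) {F G : ℝ → ℂ}
    (h : ∀ᵐ ω ∂volume.restrict (Set.Ioc 0 (2 * Real.pi / T)), F ω = G ω) :
    idtft T F = idtft T G := by
  ext n
  rw [idtft, idtft]
  have hP : 0 ≤ 2 * Real.pi / T := by positivity
  rw [intervalIntegral.integral_of_le hP, intervalIntegral.integral_of_le hP]
  congr 1
  refine integral_congr_ae ?_
  filter_upwards [h] with ω hω
  rw [hω]

theorem memLp_top_exp {T : ℝ} {φ : ℝ → ℝ} (hφ : Measurable φ) :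
    MemLp (fun ω => Complex.exp (φ ω * Complex.I)) ⊤
      (volume.restrict (Set.Ioc 0 (2 * Real.pi / T))) :=
  memLp_top_of_bound (by fun_prop) 1
    (.of_forall fun ω => (Complex.norm_exp_ofReal_mul_I (φ ω)).le)

theorem conj_exp_ofReal_mul_I (r : ℝ) :
    (starRingEnd ℂ) (Complex.exp (r * Complex.I)) = Complex.exp (-(r * Complex.I)) := by
  rw [← Complex.exp_conj]
  simp

/-- The convolution theorem for the inverse DTFT of square-integrable functions. -/
theorem seqConv_idtft {T : ℝ} (hT : 0 < T) {F G : ℝ → ℂ}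
    (hF : MemLp F 2 (volume.restrict (Set.Ioc 0 (2 * Real.pi / T))))
    (hG : MemLp G 2 (volume.restrict (Set.Ioc 0 (2 * Real.pi / T)))) :
    seqConv (idtft T F) (idtft T G) = idtft T fun ω => F ω * G ω := by
  ext n
  -- Reflecting and conjugating `F` turns the convolution at `n` into a Parseval sum: the
  -- coefficient of `F` at `n - k` is the conjugate of the coefficient of `E · conj F` at `k`.
  set E : ℝ → ℂ := fun ω => Complex.exp (((-(ω * n * T) : ℝ) : ℂ) * Complex.I) with hE
  have hE' : MemLp E ⊤ (volume.restrict (Set.Ioc 0 (2 * Real.pi / T))) :=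
    memLp_top_exp (by fun_prop)
  have hF2 : MemLp (fun ω => E ω * (starRingEnd ℂ) (F ω)) 2
      (volume.restrict (Set.Ioc 0 (2 * Real.pi / T))) := hF.star.mul hE'
  have h := (hasSum_idtft_mul_conj hT hG hF2).tsum_eq
  have h1 : ∀ k : ℤ, idtft T F (n - k) =
      (starRingEnd ℂ) (idtft T (fun ω => E ω * (starRingEnd ℂ) (F ω)) k) := by
    intro k
    have hP : 0 ≤ 2 * Real.pi / T := by positivity
    rw [idtft, idtft, map_mul, Complex.conj_ofReal, intervalIntegral.integral_of_le hP,
      intervalIntegral.integral_of_le hP, ← integral_conj, ← intervalIntegral.integral_of_le hP,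
      ← intervalIntegral.integral_of_le hP]
    congr 1
    refine intervalIntegral.integral_congr fun ω _ => ?_
    have h2 := conj_exp_ofReal_mul_I (ω * k * T)
    push_cast at h2
    simp only [map_mul, Complex.conj_conj, hE, conj_exp_ofReal_mul_I]
    rw [h2, mul_right_comm (Complex.exp _), ← Complex.exp_add, mul_comm]
    congr 2
    push_cast
    ring
  rw [seqConv]
  simp_rw [h1, mul_comm ((starRingEnd ℂ) _) _]
  rw [h, idtft]
  congr 1
  refine intervalIntegral.integral_congr fun ω _ => ?_
  simp only [map_mul, Complex.conj_conj, hE, conj_exp_ofReal_mul_I]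
  rw [mul_left_comm, mul_comm, mul_right_comm, mul_right_comm, mul_comm (G ω), mul_comm (F ω)]
  congr 2
  push_cast
  ring

theorem intervalIntegrable_mul_exp {T : ℝ} (hT : 0 < T) {F : ℝ → ℂ}
    (hF : MemLp F 2 (volume.restrict (Set.Ioc 0 (2 * Real.pi / T)))) (n : ℤ) :
    IntervalIntegrable (fun ω => F ω * Complex.exp (ω * n * T * Complex.I)) volume 0
      (2 * Real.pi / T) := by
  rw [intervalIntegrable_iff_integrableOn_Ioc_of_le (by positivity)]
  have h : MemLp (fun ω : ℝ => Complex.exp (((ω * n * T : ℝ) : ℂ) * Complex.I)) ⊤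
    (volume.restrict (Set.Ioc 0 (2 * Real.pi / T))) := memLp_top_exp (by fun_prop)
  push_cast at h
  have h2 : MemLp (fun ω : ℝ => F ω * Complex.exp (ω * n * T * Complex.I)) 2
    (volume.restrict (Set.Ioc 0 (2 * Real.pi / T))) := h.mul hF
  exact h2.integrable (by norm_num)

theorem idtft_sum {T : ℝ} (hT : 0 < T) {ι : Type*} (t : Finset ι) {F : ι → ℝ → ℂ}
    (hF : ∀ i ∈ t, MemLp (F i) 2 (volume.restrict (Set.Ioc 0 (2 * Real.pi / T)))) (n : ℤ) :
    idtft T (fun ω => ∑ i ∈ t, F i ω) n = ∑ i ∈ t, idtft T (F i) n := by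
  simp only [idtft, Finset.sum_mul, ← Finset.mul_sum]
  rw [intervalIntegral.integral_finsetSum]
  exact fun i hi => intervalIntegrable_mul_exp hT (hF i hi) n

theorem idtft_const_mul (T : ℝ) (c : ℂ) (F : ℝ → ℂ) (n : ℤ) :
    idtft T (fun ω => c * F ω) n = c * idtft T F n := by
  simp only [idtft, mul_assoc, intervalIntegral.integral_const_mul]
  ring

/-- The complex exponentials are the DTFTs of the unit impulses. -/
theorem idtft_exp {T : ℝ} (hT : 0 < T) (k n : ℤ) :
    idtft T (fun ω => Complex.exp (((-(ω * k * T) : ℝ) : ℂ) * Complex.I)) n =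
      if n = k then 1 else 0 := by
  have hP : Fact (0 < 2 * Real.pi / T) := ⟨by positivity⟩
  have h := fourierCoeff_fourier (T := 2 * Real.pi / T) (-k)
  have h2 := congrFun h (-n)
  rw [fourierCoeff_eq_intervalIntegral _ _ 0] at h2
  have h3 : (Pi.single (-k) 1 : ℤ → ℂ) (-n) = if n = k then 1 else 0 := by
    simp [Pi.single_apply]
  rw [← h3, ← h2, idtft]
  simp only [zero_add, one_div_div, Complex.real_smul]
  congr 1
  refine intervalIntegral.integral_congr fun ω _ => ?_
  simp only [fourier_coe_apply, smul_eq_mul]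
  have hpi : (Real.pi : ℂ) ≠ 0 := by exact_mod_cast Real.pi_ne_zero
  have hT' : (T : ℂ) ≠ 0 := by exact_mod_cast hT.ne'
  rw [mul_comm]
  congr 2
  · push_cast
    field_simp
  · push_cast
    field_simp

/-! ### The cross spectrum and its folding to one period -/

theorem measurable_angularFourier (f : Lp ℂ 2 (volume : Measure ℝ)) :
    Measurable (angularFourier f) :=
  (Lp.stronglyMeasurable (𝓕 f : Lp ℂ 2 (volume : Measure ℝ))).measurable.comp
    (measurable_id.div_const _)

/-- The integral over the line of a function supported in `[-PM, PM]`, folded to one period. -/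
theorem integral_eq_sum_integral_period {P : ℝ} (hP : 0 < P) (M : ℕ) {h : ℝ → ℂ}
    (hi : Integrable h) (h0 : ∀ᵐ ω : ℝ, P * M < |ω| → h ω = 0) :
    ∫ ω, h ω = ∑ m : Fin (2 * M), ∫ ω in (0 : ℝ)..P, h (ω + P * ((m : ℝ) - M)) := by
  have h1 : ∫ ω in Set.Icc (-(P * M)) (P * M), h ω = ∫ ω, h ω := by
    refine setIntegral_eq_integral_of_ae_compl_eq_zero ?_
    filter_upwards [h0] with ω hω hn
    refine hω ?_
    by_contra hcon
    exact hn (abs_le.1 (not_lt.1 hcon))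
  have hPM : 0 ≤ P * M := by positivity
  -- The breakpoints `P(k - M)`, `0 ≤ k ≤ 2M`, cut the band `[-PM, PM]` into `2M` periods.
  have h2 := intervalIntegral.sum_integral_adjacent_intervals (f := h) (μ := volume)
    (a := fun k : ℕ => P * ((k : ℝ) - M)) (n := 2 * M)
    (fun k _ => hi.intervalIntegrable)
  rw [← h1, integral_Icc_eq_integral_Ioc, ← intervalIntegral.integral_of_le (by linarith)]
  have e1 : P * (((0 : ℕ) : ℝ) - M) = -(P * M) := by push_cast; ring
  have e2 : P * (((2 * M : ℕ) : ℝ) - M) = P * M := by push_cast; ring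
  rw [e1, e2] at h2
  rw [← h2, Finset.sum_range]
  refine Finset.sum_congr rfl fun m _ => ?_
  rw [intervalIntegral.integral_comp_add_right]
  congr 1 <;> push_cast <;> ring

/-- The cross spectrum `G S*` of the pulse and the receive filter. -/
noncomputable def crossSpectrum (g s : Lp ℂ 2 (volume : Measure ℝ)) (ω : ℝ) : ℂ :=
  (starRingEnd ℂ) (angularFourier s ω) * angularFourier g ω

theorem measurable_crossSpectrum (g s : Lp ℂ 2 (volume : Measure ℝ)) :
    Measurable (crossSpectrum g s) :=
  (RCLike.continuous_conj.measurable.comp (measurable_angularFourier s)).mul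
    (measurable_angularFourier g)

theorem integrable_crossSpectrum (g s : Lp ℂ 2 (volume : Measure ℝ)) :
    Integrable (crossSpectrum g s) := by
  have h := (L2.integrable_inner (𝕜 := ℂ) (𝓕 s) (𝓕 g)).comp_div
    (R := 2 * Real.pi) (by positivity)
  refine h.congr (.of_forall fun ω => ?_)
  simp only [RCLike.inner_apply, crossSpectrum, angularFourier]
  ring

theorem integral_crossSpectrum (g s : Lp ℂ 2 (volume : Measure ℝ)) (b : ℝ) :
    ∫ ξ, 𝓕 g ξ * (starRingEnd ℂ) (𝓕 s ξ) * Complex.exp (2 * Real.pi * ξ * b * Complex.I) =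
      (1 / (2 * Real.pi) : ℝ) * ∫ ω : ℝ, crossSpectrum g s ω * Complex.exp (ω * b * Complex.I) := by
  have h := Measure.integral_comp_div
    (fun ξ : ℝ => 𝓕 g ξ * (starRingEnd ℂ) (𝓕 s ξ) *
      Complex.exp (2 * Real.pi * ξ * b * Complex.I)) (2 * Real.pi)
  rw [abs_of_pos (by positivity), Complex.real_smul] at h
  have h3 : ∫ ω : ℝ, crossSpectrum g s ω * Complex.exp (ω * b * Complex.I) =
      ∫ x : ℝ, 𝓕 g (x / (2 * Real.pi)) * (starRingEnd ℂ) (𝓕 s (x / (2 * Real.pi))) *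
        Complex.exp (2 * Real.pi * ((x / (2 * Real.pi) : ℝ) : ℂ) * b * Complex.I) := by
    refine integral_congr_ae (.of_forall fun ω => ?_)
    simp only [crossSpectrum, angularFourier]
    rw [mul_comm ((starRingEnd ℂ) _)]
    congr 3
    push_cast
    have hpi : (Real.pi : ℂ) ≠ 0 := by exact_mod_cast Real.pi_ne_zero
    field_simp
  rw [h3, h, ← mul_assoc, ← Complex.ofReal_mul, one_div, inv_mul_cancel₀ (by positivity),
    Complex.ofReal_one, one_mul]

/-- For `0 ≤ m < 2M` the period `(0, P]` shifted by `P(m - M)` stays inside the band, and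
translations preserve null sets. -/
theorem ae_shift_period {P : ℝ} {M : ℕ} {p : ℝ → Prop}
    (h : ∀ᵐ ω : ℝ, |ω| ≤ P * M → p ω) (m : Fin (2 * M)) (hP : 0 < P) :
    ∀ᵐ ω ∂volume.restrict (Set.Ioc 0 P), p (ω + P * ((m : ℝ) - M)) := by
  have h1 := (measurePreserving_add_right (volume : Measure ℝ)
    (P * ((m : ℝ) - M))).quasiMeasurePreserving.ae h
  rw [ae_restrict_iff' measurableSet_Ioc]
  filter_upwards [h1] with ω hω hmem
  refine hω (abs_le.2 ?_)
  have hm : (m : ℝ) + 1 ≤ 2 * M := by exact_mod_cast m.2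
  have hm0 : (0 : ℝ) ≤ m := Nat.cast_nonneg _
  constructor <;> nlinarith [hmem.1, hmem.2]

/-- `e^{-jω(τ+kT)}`, the spectral factor of an echo at delay `τ` of the `k`-th pulse. -/
noncomputable def echoPhase (T τ : ℝ) (k : ℕ) (ω : ℝ) : ℂ :=
  Complex.exp (((-(ω * (τ + k * T)) : ℝ) : ℂ) * Complex.I)

theorem memLp_echoPhase (T τ : ℝ) (k : ℕ) :
    MemLp (echoPhase T τ k) ⊤ (volume.restrict (Set.Ioc 0 (2 * Real.pi / T))) :=
  memLp_top_exp (by fun_prop)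

theorem samplingMatrix_apply (T : ℝ) (M : ℕ) (g s : Lp ℂ 2 (volume : Measure ℝ)) (ω : ℝ)
    (l m : Fin (2 * M)) :
    samplingMatrix T M g s ω l m = 1 / T *
      Complex.exp (((ω * l * T / (2 * M) : ℝ) : ℂ) * Complex.I) *
      crossSpectrum g s (ω + 2 * Real.pi / T * ((m : ℝ) - M)) *
      Complex.exp (((2 * Real.pi / (2 * M) * l * ((m : ℝ) - M) : ℝ) : ℂ) * Complex.I) := by
  simp only [samplingMatrix, Matrix.of_apply, crossSpectrum]
  push_cast
  ring

theorem delayMatrix_apply (T : ℝ) (M : ℕ) {r : ℕ} (τ : Fin r → ℝ) (m : Fin (2 * M)) (i : Fin r) :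
    delayMatrix T M τ m i =
      Complex.exp (((-(2 * Real.pi / T * ((m : ℝ) - M) * τ i) : ℝ) : ℂ) * Complex.I) := by
  simp only [delayMatrix, Matrix.of_apply]
  push_cast
  rfl

theorem FillsBand.ae_crossSpectrum {W : ℝ} {g s : Lp ℂ 2 (volume : Measure ℝ)}
    (hg : FillsBand W g) (hs : FillsBand W s) :
    (∀ᵐ ω : ℝ, W / 2 < |ω| → crossSpectrum g s ω = 0) ∧
    ∃ a b : ℝ, 0 < a ∧ ∀ᵐ ω : ℝ, |ω| ≤ W / 2 →
      a ≤ ‖crossSpectrum g s ω‖ ∧ ‖crossSpectrum g s ω‖ ≤ b := by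
  obtain ⟨hg0, ag, bg, hag, hgb⟩ := hg
  obtain ⟨-, as, bs, has, hsb⟩ := hs
  refine ⟨?_, as * ag, bs * bg, by positivity, ?_⟩
  · filter_upwards [hg0] with ω h h1
    rw [crossSpectrum, h h1, mul_zero]
  · filter_upwards [hgb, hsb] with ω h1 h2 h
    obtain ⟨h3, h4⟩ := h1 h
    obtain ⟨h5, h6⟩ := h2 h
    rw [crossSpectrum, norm_mul, RCLike.norm_conj]
    exact ⟨by gcongr, by gcongr; exact (norm_nonneg _).trans h6⟩

/-! ### Samples of a single echo -/

section Sampling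

variable {W T : ℝ} {M : ℕ} {g s : Lp ℂ 2 (volume : Measure ℝ)}

theorem half_bandwidth_eq (hT : 0 < T) (hWT : W = 4 * Real.pi * M / T) :
    W / 2 = 2 * Real.pi / T * M := by
  rw [hWT]; field_simp; ring

theorem ae_crossSpectrum_shift (hT : 0 < T) (hWT : W = 4 * Real.pi * M / T)
    (hg : FillsBand W g) (hs : FillsBand W s) : ∃ a b : ℝ, 0 < a ∧
      ∀ᵐ ω ∂volume.restrict (Set.Ioc 0 (2 * Real.pi / T)), ∀ m : Fin (2 * M),
        a ≤ ‖crossSpectrum g s (ω + 2 * Real.pi / T * ((m : ℝ) - M))‖ ∧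
        ‖crossSpectrum g s (ω + 2 * Real.pi / T * ((m : ℝ) - M))‖ ≤ b := by
  obtain ⟨-, a, b, ha, hab⟩ := hg.ae_crossSpectrum hs
  rw [half_bandwidth_eq hT hWT] at hab
  exact ⟨a, b, ha, ae_all_iff.2 fun m => ae_shift_period hab m (by positivity)⟩

theorem memLp_samplingMatrix (hT : 0 < T) (hWT : W = 4 * Real.pi * M / T)
    (hg : FillsBand W g) (hs : FillsBand W s) (l m : Fin (2 * M)) :
    MemLp (fun ω => samplingMatrix T M g s ω l m) ⊤
      (volume.restrict (Set.Ioc 0 (2 * Real.pi / T))) := by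
  obtain ⟨a, b, ha, hab⟩ := ae_crossSpectrum_shift hT hWT hg hs
  simp only [samplingMatrix_apply]
  have hc : MemLp (fun ω => crossSpectrum g s (ω + 2 * Real.pi / T * ((m : ℝ) - M))) ⊤
      (volume.restrict (Set.Ioc 0 (2 * Real.pi / T))) := by
    refine memLp_top_of_bound ?_ b ?_
    · exact ((measurable_crossSpectrum g s).comp (by fun_prop)).aestronglyMeasurable
    · filter_upwards [hab] with ω hω using (hω m).2
  have he : MemLp (fun ω : ℝ => Complex.exp (((ω * l * T / (2 * M) : ℝ) : ℂ) * Complex.I)) ⊤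
      (volume.restrict (Set.Ioc 0 (2 * Real.pi / T))) := memLp_top_exp (by fun_prop)
  have h1 : MemLp (fun ω : ℝ => 1 / T *
      Complex.exp (((ω * l * T / (2 * M) : ℝ) : ℂ) * Complex.I) *
      crossSpectrum g s (ω + 2 * Real.pi / T * ((m : ℝ) - M))) ⊤
      (volume.restrict (Set.Ioc 0 (2 * Real.pi / T))) := hc.mul (he.const_mul _)
  simpa only [mul_comm] using h1.const_mul
    (Complex.exp (((2 * Real.pi / (2 * M) * l * ((m : ℝ) - M) : ℝ) : ℂ) * Complex.I))

/-- One echo of one pulse, filtered and sampled. -/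
theorem lpf_echo_eq_idtft (hT : 0 < T) (hM : 0 < M) (hWT : W = 4 * Real.pi * M / T)
    (hg : FillsBand W g) (hs : FillsBand W s) (τ : ℝ) (k : ℕ) (l : Fin (2 * M)) (n : ℤ) :
    ∫ u, g (u - τ - k * T) * (starRingEnd ℂ) (s (u - 2 * (n * (2 * M : ℕ) + l) * Real.pi / W)) =
      idtft T (fun ω => ∑ m, samplingMatrix T M g s ω l m *
        (delayMatrix T M (fun _ : Fin 1 => τ) m 0 * echoPhase T τ k ω)) n := by
  have hW2 := half_bandwidth_eq hT hWT
  set b : ℝ := 2 * (n * (2 * M : ℕ) + l) * Real.pi / W - (τ + k * T) with hb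
  have hpi := Real.pi_pos
  have hbn : b = n * T + l * T / (2 * M) - (τ + k * T) := by
    rw [hb, hWT]
    push_cast
    field_simp
    ring
  have h1 := integral_translate_mul_conj_translate g s (τ + k * T)
    (2 * (n * (2 * M : ℕ) + l) * Real.pi / W)
  simp only [← sub_sub] at h1
  rw [h1]
  have h2 := integral_crossSpectrum g s b
  have h3 : ∫ ξ, 𝓕 g ξ * (starRingEnd ℂ) (𝓕 s ξ) * Complex.exp (2 * Real.pi * ξ *
      (((2 * (n * (2 * M : ℕ) + l) * Real.pi / W : ℝ) : ℂ) - ((τ + k * T : ℝ) : ℂ)) * Complex.I)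
      = ∫ ξ, 𝓕 g ξ * (starRingEnd ℂ) (𝓕 s ξ) *
        Complex.exp (2 * Real.pi * ξ * b * Complex.I) := by
    simp only [hb, Complex.ofReal_sub]
  rw [h3, h2]
  have hint : Integrable fun ω : ℝ => crossSpectrum g s ω * Complex.exp (ω * b * Complex.I) := by
    have h := (integrable_crossSpectrum g s).mul_bdd (c := 1)
      (g := fun ω : ℝ => Complex.exp (((ω * b : ℝ) : ℂ) * Complex.I))
      (by fun_prop)
      (.of_forall fun ω => (Complex.norm_exp_ofReal_mul_I (ω * b)).le)
    simpa using h
  rw [integral_eq_sum_integral_period (P := 2 * Real.pi / T) (by positivity) M hint]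
  swap
  · filter_upwards [(hg.ae_crossSpectrum hs).1] with ω h h'
    rw [h (by rwa [hW2]), zero_mul]
  rw [idtft_sum hT Finset.univ]
  swap
  · intro m _
    have h4 := (memLp_samplingMatrix hT hWT hg hs l m)
    have h5 := (memLp_echoPhase T τ k).const_mul (delayMatrix T M (fun _ : Fin 1 => τ) m 0)
    exact (h5.mul h4 : MemLp _ ⊤ _).mono_exponent le_top
  rw [Finset.mul_sum]
  refine Finset.sum_congr rfl fun m _ => ?_
  rw [idtft]
  have hT' : (T : ℂ) ≠ 0 := by exact_mod_cast hT.ne'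
  have hpi' : (Real.pi : ℂ) ≠ 0 := by exact_mod_cast hpi.ne'
  have hM' : (M : ℂ) ≠ 0 := by exact_mod_cast hM.ne'
  -- The factor `1/(2π)` splits into the normalization of the inverse DTFT and the `1/T` inside the
  -- sampling matrix.
  have e : ((1 / (2 * Real.pi) : ℝ) : ℂ) = ((T / (2 * Real.pi) : ℝ) : ℂ) * (1 / T) := by
    push_cast
    field_simp
  rw [e, mul_assoc, ← intervalIntegral.integral_const_mul]
  congr 1
  refine intervalIntegral.integral_congr fun ω _ => ?_
  simp only [samplingMatrix_apply, delayMatrix_apply, echoPhase]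
  have hexp : Complex.exp (((ω + 2 * Real.pi / T * ((m : ℝ) - M) : ℝ) : ℂ) * b * Complex.I) =
      Complex.exp (((ω * l * T / (2 * M) : ℝ) : ℂ) * Complex.I) *
      Complex.exp (((2 * Real.pi / (2 * M) * l * ((m : ℝ) - M) : ℝ) : ℂ) * Complex.I) *
      (Complex.exp (((-(2 * Real.pi / T * ((m : ℝ) - M) * τ) : ℝ) : ℂ) * Complex.I) *
      Complex.exp (((-(ω * (τ + k * T)) : ℝ) : ℂ) * Complex.I)) *
      Complex.exp (ω * n * T * Complex.I) := by
    rw [← Complex.exp_add, ← Complex.exp_add, ← Complex.exp_add, ← Complex.exp_add,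
      Complex.exp_eq_exp_iff_exists_int]
    -- The two phases differ by `(2π/T) m' (n - k) T`, an integer multiple of `2π`: whole pulse
    -- periods are invisible to the shifts `(2π/T) m'`.
    refine ⟨((m : ℤ) - M) * (n - k), ?_⟩
    rw [hbn]
    push_cast
    field_simp
    ring
  rw [hexp]
  ring

end Sampling

/-! ### Inverting the sampling matrix -/

/-- Orthogonality of the columns of the DFT matrix, by summing a geometric series over a `2M`-th
root of unity. -/
theorem sum_exp_fin_eq_ite {M : ℕ} (m₁ m₂ : Fin (2 * M)) :
    ∑ l : Fin (2 * M),
      Complex.exp (((2 * Real.pi / (2 * M) * l * ((m₂ : ℝ) - m₁) : ℝ) : ℂ) * Complex.I) =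
      if m₁ = m₂ then (2 * M : ℂ) else 0 := by
  split_ifs with h
  · subst h
    simp
  have hM : (M : ℂ) ≠ 0 := by
    have : M ≠ 0 := by rintro rfl; exact m₁.elim0
    exact_mod_cast this
  have hpi : (Real.pi : ℂ) ≠ 0 := by exact_mod_cast Real.pi_ne_zero
  set ζ : ℂ := Complex.exp (((2 * Real.pi / (2 * M) * ((m₂ : ℝ) - m₁) : ℝ) : ℂ) * Complex.I)
    with hζ
  have hsum : ∀ l : Fin (2 * M),
      Complex.exp (((2 * Real.pi / (2 * M) * l * ((m₂ : ℝ) - m₁) : ℝ) : ℂ) * Complex.I) =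
        ζ ^ (l : ℕ) := by
    intro l
    rw [hζ, ← Complex.exp_nat_mul]
    congr 1
    push_cast
    ring
  simp_rw [hsum]
  rw [← Finset.sum_range (fun l => ζ ^ l)]
  have hpow : ζ ^ (2 * M) = 1 := by
    rw [hζ, ← Complex.exp_nat_mul, Complex.exp_eq_one_iff]
    refine ⟨(m₂ : ℤ) - m₁, ?_⟩
    push_cast
    field_simp
  have hne : ζ ≠ 1 := by
    intro h1
    obtain ⟨n, hn⟩ := Complex.exp_eq_one_iff.1 h1
    have h2 : ((m₂ : ℤ) - m₁ : ℂ) = n * (2 * M) := by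
      push_cast at hn
      field_simp at hn
      push_cast
      linear_combination hn
    have h3 : (m₂ : ℤ) - m₁ = n * (2 * M) := by exact_mod_cast h2
    have h4 := m₁.2
    have h5 := m₂.2
    have h6 : n = 0 := by
      by_contra hn0
      rcases lt_or_gt_of_ne hn0 with h | h
      · nlinarith
      · nlinarith
    rw [h6] at h3
    exact h (Fin.ext (by omega))
  have := geom_sum_mul ζ (2 * M)
  rw [hpow, sub_self] at this
  exact (mul_eq_zero.1 this).resolve_right (sub_ne_zero.2 hne)

section Correction

variable {W T : ℝ} {M : ℕ} {g s : Lp ℂ 2 (volume : Measure ℝ)}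

/-- The sampling matrix is a diagonal phase in `l`, times a DFT matrix, times the diagonal of
shifted cross spectra. Each factor is inverted separately. -/
theorem samplingMatrix_inv (hT : 0 < T) {ω : ℝ}
    (hω : ∀ m : Fin (2 * M), crossSpectrum g s (ω + 2 * Real.pi / T * ((m : ℝ) - M)) ≠ 0) :
    (Matrix.of fun m l : Fin (2 * M) => (T / (2 * M) : ℂ) *
      (crossSpectrum g s (ω + 2 * Real.pi / T * ((m : ℝ) - M)))⁻¹ *
      Complex.exp (((-(ω * l * T / (2 * M)) : ℝ) : ℂ) * Complex.I) *
      Complex.exp (((-(2 * Real.pi / (2 * M) * l * ((m : ℝ) - M)) : ℝ) : ℂ) * Complex.I)) *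
      samplingMatrix T M g s ω = 1 := by
  ext m₁ m₂
  have hM : (M : ℂ) ≠ 0 := by
    have : M ≠ 0 := by rintro rfl; exact m₁.elim0
    exact_mod_cast this
  have hT' : (T : ℂ) ≠ 0 := by exact_mod_cast hT.ne'
  rw [Matrix.mul_apply]
  have key : ∀ l : Fin (2 * M), (Matrix.of fun m l : Fin (2 * M) => (T / (2 * M) : ℂ) *
      (crossSpectrum g s (ω + 2 * Real.pi / T * ((m : ℝ) - M)))⁻¹ *
      Complex.exp (((-(ω * l * T / (2 * M)) : ℝ) : ℂ) * Complex.I) *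
      Complex.exp (((-(2 * Real.pi / (2 * M) * l * ((m : ℝ) - M)) : ℝ) : ℂ) * Complex.I)) m₁ l *
      samplingMatrix T M g s ω l m₂ = (1 / (2 * M) : ℂ) *
      ((crossSpectrum g s (ω + 2 * Real.pi / T * ((m₁ : ℝ) - M)))⁻¹ *
        crossSpectrum g s (ω + 2 * Real.pi / T * ((m₂ : ℝ) - M))) *
      Complex.exp (((2 * Real.pi / (2 * M) * l * ((m₂ : ℝ) - m₁) : ℝ) : ℂ) * Complex.I) := by
    intro l
    rw [samplingMatrix_apply, Matrix.of_apply]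
    have h1 : Complex.exp (((-(ω * l * T / (2 * M)) : ℝ) : ℂ) * Complex.I) *
        Complex.exp (((ω * l * T / (2 * M) : ℝ) : ℂ) * Complex.I) = 1 := by
      rw [← Complex.exp_add, ← add_mul, ← Complex.ofReal_add, neg_add_cancel]
      simp
    have h2 : Complex.exp (((2 * Real.pi / (2 * M) * l * ((m₂ : ℝ) - m₁) : ℝ) : ℂ) * Complex.I) =
        Complex.exp (((-(2 * Real.pi / (2 * M) * l * ((m₁ : ℝ) - M)) : ℝ) : ℂ) * Complex.I) *
        Complex.exp (((2 * Real.pi / (2 * M) * l * ((m₂ : ℝ) - M) : ℝ) : ℂ) * Complex.I) := by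
      rw [← Complex.exp_add, ← add_mul, ← Complex.ofReal_add]
      congr 3
      ring
    have h3 : (T / (2 * M) : ℂ) * (1 / T) = 1 / (2 * M) := by field_simp
    rw [h2, ← h3]
    linear_combination ((T / (2 * M) : ℂ) * (1 / T) *
      ((crossSpectrum g s (ω + 2 * Real.pi / T * ((m₁ : ℝ) - M)))⁻¹ *
        crossSpectrum g s (ω + 2 * Real.pi / T * ((m₂ : ℝ) - M))) *
      (Complex.exp (((-(2 * Real.pi / (2 * M) * l * ((m₁ : ℝ) - M)) : ℝ) : ℂ) * Complex.I) *
        Complex.exp (((2 * Real.pi / (2 * M) * l * ((m₂ : ℝ) - M) : ℝ) : ℂ) * Complex.I))) * h1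
  rw [Finset.sum_congr rfl fun l _ => key l, ← Finset.mul_sum, sum_exp_fin_eq_ite,
    Matrix.one_apply]
  split_ifs with h
  · subst h
    rw [inv_mul_cancel₀ (hω _)]
    field_simp
  · rw [mul_zero]

theorem ae_samplingMatrix_inv_mul (hT : 0 < T) (hWT : W = 4 * Real.pi * M / T)
    (hg : FillsBand W g) (hs : FillsBand W s) :
    ∀ᵐ ω ∂volume.restrict (Set.Ioc 0 (2 * Real.pi / T)),
      (samplingMatrix T M g s ω)⁻¹ * samplingMatrix T M g s ω = 1 := by
  obtain ⟨a, b, ha, hab⟩ := ae_crossSpectrum_shift hT hWT hg hs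
  filter_upwards [hab] with ω hω
  have h := samplingMatrix_inv (g := g) (s := s) (M := M) hT (ω := ω)
    fun m => norm_pos_iff.1 (ha.trans_le (hω m).1)
  rw [Matrix.inv_eq_left_inv h, h]

/-- The explicit inverse contains the reciprocal of the cross spectrum, so the lower bound on the
band makes the correction filters essentially bounded. -/
theorem memLp_samplingMatrix_inv (hT : 0 < T) (hWT : W = 4 * Real.pi * M / T)
    (hg : FillsBand W g) (hs : FillsBand W s) (m l : Fin (2 * M)) :
    MemLp (fun ω => (samplingMatrix T M g s ω)⁻¹ m l) ⊤
      (volume.restrict (Set.Ioc 0 (2 * Real.pi / T))) := by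
  obtain ⟨a, b, ha, hab⟩ := ae_crossSpectrum_shift hT hWT hg hs
  have hc : MemLp (fun ω => (crossSpectrum g s (ω + 2 * Real.pi / T * ((m : ℝ) - M)))⁻¹) ⊤
      (volume.restrict (Set.Ioc 0 (2 * Real.pi / T))) := by
    refine memLp_top_of_bound ?_ a⁻¹ ?_
    · exact ((measurable_crossSpectrum g s).comp (by fun_prop)).inv.aestronglyMeasurable
    · filter_upwards [hab] with ω hω
      rw [norm_inv]
      exact inv_anti₀ ha (hω m).1
  have he : MemLp (fun ω : ℝ => Complex.exp (((-(ω * l * T / (2 * M)) : ℝ) : ℂ) * Complex.I)) ⊤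
      (volume.restrict (Set.Ioc 0 (2 * Real.pi / T))) := memLp_top_exp (by fun_prop)
  have h1 : MemLp (fun ω : ℝ => (T / (2 * M) : ℂ) *
      (crossSpectrum g s (ω + 2 * Real.pi / T * ((m : ℝ) - M)))⁻¹ *
      Complex.exp (((-(ω * l * T / (2 * M)) : ℝ) : ℂ) * Complex.I)) ⊤
      (volume.restrict (Set.Ioc 0 (2 * Real.pi / T))) := he.mul (hc.const_mul _)
  have h2 := h1.const_mul
    (Complex.exp (((-(2 * Real.pi / (2 * M) * l * ((m : ℝ) - M)) : ℝ) : ℂ) * Complex.I))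
  refine h2.ae_eq ?_
  filter_upwards [hab] with ω hω
  have h := samplingMatrix_inv (g := g) (s := s) (M := M) hT (ω := ω)
    fun m => norm_pos_iff.1 (ha.trans_le (hω m).1)
  rw [Matrix.inv_eq_left_inv h, Matrix.of_apply, mul_comm]

theorem memLp_samplingMatrix_mulVec (hT : 0 < T) (hWT : W = 4 * Real.pi * M / T)
    (hg : FillsBand W g) (hs : FillsBand W s) {F : Fin (2 * M) → ℝ → ℂ}
    (hF : ∀ m, MemLp (F m) ⊤ (volume.restrict (Set.Ioc 0 (2 * Real.pi / T))))
    (l : Fin (2 * M)) :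
    MemLp (fun ω => ∑ m, samplingMatrix T M g s ω l m * F m ω) ⊤
      (volume.restrict (Set.Ioc 0 (2 * Real.pi / T))) :=
  memLp_finsetSum _ fun m _ => (hF m).mul (memLp_samplingMatrix hT hWT hg hs l m)

end Correction

/-! ### The modified measurements as a superposition of delayed sequences -/

namespace DelayDoppler

variable {W T : ℝ} {M : ℕ} {g s : Lp ℂ 2 (volume : Measure ℝ)}

/-- `e^{-jωτ_i} A_i(e^{jωT})`, where `A_i` is the DTFT of `a_i`. -/
noncomputable def echoSpectrum (H : DelayDoppler) (T : ℝ) (N : ℕ) (x : ℕ → ℂ)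
    (i : Fin H.numDelays) (ω : ℝ) : ℂ :=
  ∑ k ∈ Finset.range N, H.coeffSeq T x i k * echoPhase T (H.delay i) k ω

theorem memLp_echoSpectrum (H : DelayDoppler) (T : ℝ) (N : ℕ) (x : ℕ → ℂ)
    (i : Fin H.numDelays) :
    MemLp (H.echoSpectrum T N x i) ⊤ (volume.restrict (Set.Ioc 0 (2 * Real.pi / T))) :=
  memLp_finsetSum _ fun k _ => (memLp_echoPhase T (H.delay i) k).const_mul _

/-- The DTFT of the modified measurements `d_m`. -/
noncomputable def fieldSpectrum (H : DelayDoppler) (T : ℝ) (M N : ℕ) (x : ℕ → ℂ)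
    (m : Fin (2 * M)) (ω : ℝ) : ℂ :=
  ∑ i, delayMatrix T M H.delay m i * H.echoSpectrum T N x i ω

theorem memLp_fieldSpectrum (H : DelayDoppler) (T : ℝ) (M N : ℕ) (x : ℕ → ℂ)
    (m : Fin (2 * M)) :
    MemLp (H.fieldSpectrum T M N x m) ⊤ (volume.restrict (Set.Ioc 0 (2 * Real.pi / T))) :=
  memLp_finsetSum _ fun i _ => (H.memLp_echoSpectrum T N x i).const_mul _

/-- Superposition of the single-echo formula. There are finitely many echoes, so only integrability
is needed to exchange sums and integrals. -/
theorem sampleSeq_eq_idtft (H : DelayDoppler) (hT : 0 < T) (hM : 0 < M)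
    (hWT : W = 4 * Real.pi * M / T) (hg : FillsBand W g) (hs : FillsBand W s)
    {N : ℕ} {x : ℕ → ℂ} {y : ℝ → ℂ} (hy : y =ᵐ[volume] H.output T N x g) (l : Fin (2 * M)) :
    sampleSeq W (2 * M) s y l =
      idtft T fun ω => ∑ m, samplingMatrix T M g s ω l m * H.fieldSpectrum T M N x m ω := by
  ext n
  set t : ℝ := 2 * (n * (2 * M : ℕ) + l) * Real.pi / W with ht
  have h1 : sampleSeq W (2 * M) s y l n = ∫ u, ∑ i, ∑ k ∈ Finset.range N,
      H.coeffSeq T x i k * (g (u - H.delay i - k * T) * (starRingEnd ℂ) (s (u - t))) := by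
    rw [sampleSeq, lpfOutput]
    refine integral_congr_ae ?_
    filter_upwards [hy] with u hu
    rw [hu, output, Finset.sum_mul]
    refine Finset.sum_congr rfl fun i _ => ?_
    rw [Finset.sum_mul]
    exact Finset.sum_congr rfl fun k _ => mul_assoc _ _ _
  have hint : ∀ (i : Fin H.numDelays) (k : ℕ), Integrable fun u =>
      H.coeffSeq T x i k * (g (u - H.delay i - k * T) * (starRingEnd ℂ) (s (u - t))) := by
    intro i k
    have := (integrable_translate_mul_conj_translate g s (H.delay i + k * T) t).const_mul
      (H.coeffSeq T x i k)
    simpa only [← sub_sub] using this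
  rw [h1, integral_finsetSum _ fun i _ => integrable_finsetSum _ fun k _ => hint i k]
  have hterm : ∀ (i : Fin H.numDelays) (k : ℕ), MemLp (fun ω => H.coeffSeq T x i k *
      (∑ m, samplingMatrix T M g s ω l m *
        (delayMatrix T M (fun _ : Fin 1 => H.delay i) m 0 * echoPhase T (H.delay i) k ω))) 2
      (volume.restrict (Set.Ioc 0 (2 * Real.pi / T))) := by
    intro i k
    have h := memLp_samplingMatrix_mulVec hT hWT hg hs (l := l) fun m =>
      (memLp_echoPhase T (H.delay i) k).const_mul
        (delayMatrix T M (fun _ : Fin 1 => H.delay i) m 0)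
    exact (h.mono_exponent le_top).const_mul _
  have hfun : (fun ω => ∑ m, samplingMatrix T M g s ω l m * H.fieldSpectrum T M N x m ω) =
      fun ω => ∑ i, ∑ k ∈ Finset.range N, H.coeffSeq T x i k *
        ∑ m, samplingMatrix T M g s ω l m *
        (delayMatrix T M (fun _ : Fin 1 => H.delay i) m 0 * echoPhase T (H.delay i) k ω) := by
    ext ω
    simp only [fieldSpectrum, echoSpectrum, Finset.mul_sum]
    rw [Finset.sum_comm]
    refine Finset.sum_congr rfl fun i _ => ?_
    rw [Finset.sum_comm]
    refine Finset.sum_congr rfl fun k _ => Finset.sum_congr rfl fun m _ => ?_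
    simp only [delayMatrix, Matrix.of_apply]
    ring
  rw [hfun, idtft_sum hT _ fun i _ => memLp_finsetSum _ fun k _ => hterm i k]
  refine Finset.sum_congr rfl fun i _ => ?_
  rw [integral_finsetSum _ fun k _ => hint i k, idtft_sum hT _ fun k _ => hterm i k]
  refine Finset.sum_congr rfl fun k _ => ?_
  rw [integral_const_mul, idtft_const_mul, lpf_echo_eq_idtft hT hM hWT hg hs]

/-- The correction filter bank undoes the sampling matrix. -/
theorem modifiedSeq_eq_idtft (H : DelayDoppler) (hT : 0 < T) (hM : 0 < M)
    (hWT : W = 4 * Real.pi * M / T) (hg : FillsBand W g) (hs : FillsBand W s)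
    {N : ℕ} {x : ℕ → ℂ} {y : ℝ → ℂ} (hy : y =ᵐ[volume] H.output T N x g) (m : Fin (2 * M)) :
    modifiedSeq W T M g s y m = idtft T (H.fieldSpectrum T M N x m) := by
  have hC : ∀ l : Fin (2 * M), MemLp (fun ω => ∑ m, samplingMatrix T M g s ω l m *
      H.fieldSpectrum T M N x m ω) ⊤ (volume.restrict (Set.Ioc 0 (2 * Real.pi / T))) :=
    memLp_samplingMatrix_mulVec hT hWT hg hs (H.memLp_fieldSpectrum T M N x)
  have hI := memLp_samplingMatrix_inv hT hWT hg hs m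
  ext n
  have h1 : ∀ l, seqConv (idtft T fun ω => (samplingMatrix T M g s ω)⁻¹ m l)
      (sampleSeq W (2 * M) s y l) n = idtft T (fun ω => (samplingMatrix T M g s ω)⁻¹ m l *
        ∑ m, samplingMatrix T M g s ω l m * H.fieldSpectrum T M N x m ω) n := by
    intro l
    rw [H.sampleSeq_eq_idtft hT hM hWT hg hs hy,
      seqConv_idtft hT ((hI l).mono_exponent le_top) ((hC l).mono_exponent le_top)]
  rw [modifiedSeq, Finset.sum_congr rfl fun l _ => h1 l, ← idtft_sum hT]
  swap
  · exact fun l _ => ((hC l).mul (hI l) : MemLp _ ⊤ _).mono_exponent le_top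
  refine congrFun (idtft_congr hT ?_) n
  filter_upwards [ae_samplingMatrix_inv_mul hT hWT hg hs] with ω hω
  have h2 : (samplingMatrix T M g s ω)⁻¹ *ᵥ (samplingMatrix T M g s ω *ᵥ
      fun m => H.fieldSpectrum T M N x m ω) = fun m => H.fieldSpectrum T M N x m ω := by
    rw [Matrix.mulVec_mulVec, hω, Matrix.one_mulVec]
  exact congrFun h2 m

/-- The delayed sequence `b_i`, whose DTFT is `e^{-jωτ_i} A_i(e^{jωT})`. -/
noncomputable def echoSeq (H : DelayDoppler) (T : ℝ) (N : ℕ) (x : ℕ → ℂ)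
    (i : Fin H.numDelays) : ℤ → ℂ :=
  idtft T (H.echoSpectrum T N x i)

/-- All dependence on `ω` sits in the echo spectra; the delay matrix is constant and passes through
the inverse DTFT. -/
theorem modifiedSeq_eq_sum (H : DelayDoppler) (hT : 0 < T) (hM : 0 < M)
    (hWT : W = 4 * Real.pi * M / T) (hg : FillsBand W g) (hs : FillsBand W s)
    {N : ℕ} {x : ℕ → ℂ} {y : ℝ → ℂ} (hy : y =ᵐ[volume] H.output T N x g) (m : Fin (2 * M))
    (n : ℤ) :
    modifiedSeq W T M g s y m n = ∑ i, delayMatrix T M H.delay m i * H.echoSeq T N x i n := by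
  rw [H.modifiedSeq_eq_idtft hT hM hWT hg hs hy]
  have h := idtft_sum hT Finset.univ
    (F := fun i ω => delayMatrix T M H.delay m i * H.echoSpectrum T N x i ω)
    (fun i _ => ((H.memLp_echoSpectrum T N x i).mono_exponent le_top).const_mul _) n
  simp only [idtft_const_mul] at h
  exact h

/-- The filter `e^{jωτ_i}` cancels the delay in every echo phase and leaves a trigonometric
polynomial in `ωT`, whose coefficients are the `a_i[n]`. -/
theorem seqConv_echoSeq (H : DelayDoppler) (hT : 0 < T) (N : ℕ) (x : ℕ → ℂ)
    (i : Fin H.numDelays) (n : ℕ) :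
    seqConv (idtft T fun ω => Complex.exp (ω * H.delay i * Complex.I)) (H.echoSeq T N x i) n =
      if n < N then H.coeffSeq T x i n else 0 := by
  have hE : MemLp (fun ω : ℝ => Complex.exp (ω * H.delay i * Complex.I)) ⊤
      (volume.restrict (Set.Ioc 0 (2 * Real.pi / T))) := by
    have h : MemLp (fun ω : ℝ => Complex.exp (((ω * H.delay i : ℝ) : ℂ) * Complex.I)) ⊤
      (volume.restrict (Set.Ioc 0 (2 * Real.pi / T))) := memLp_top_exp (by fun_prop)
    simpa only [Complex.ofReal_mul] using h
  rw [echoSeq, seqConv_idtft hT (hE.mono_exponent le_top)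
    ((H.memLp_echoSpectrum T N x i).mono_exponent le_top)]
  have hfun : (fun ω : ℝ => Complex.exp (ω * H.delay i * Complex.I) * H.echoSpectrum T N x i ω) =
      fun ω => ∑ k ∈ Finset.range N, H.coeffSeq T x i k *
        Complex.exp (((-(ω * (k : ℤ) * T) : ℝ) : ℂ) * Complex.I) := by
    ext ω
    rw [echoSpectrum, Finset.mul_sum]
    refine Finset.sum_congr rfl fun k _ => ?_
    rw [echoPhase, mul_left_comm, ← Complex.exp_add]
    congr 2
    push_cast
    ring
  rw [hfun, idtft_sum hT _ fun k _ => MemLp.const_mul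
    ((memLp_top_exp (by fun_prop)).mono_exponent le_top) _]
  simp only [idtft_const_mul, idtft_exp hT, Nat.cast_inj]
  simp

theorem summable_echoSeq_mul_conj (H : DelayDoppler) (hT : 0 < T) (N : ℕ) (x : ℕ → ℂ)
    (i j : Fin H.numDelays) :
    Summable fun n => H.echoSeq T N x i n * (starRingEnd ℂ) (H.echoSeq T N x j n) :=
  (hasSum_idtft_mul_conj hT ((H.memLp_echoSpectrum T N x i).mono_exponent le_top)
    ((H.memLp_echoSpectrum T N x j).mono_exponent le_top)).summable

end DelayDoppler

/-! ### Pseudoinverses, Vandermonde matrices and ESPRIT -/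

section LinearAlgebra

open scoped ComplexOrder

/-- Injectivity makes `(AᴴA)⁻¹Aᴴ` a Penrose inverse, so the choice operator does return one;
cancelling `A` in `A A† A = A` finishes. Uniqueness of the pseudoinverse is not needed. -/
theorem pinv_mul_self {m n : ℕ} {A : Matrix (Fin m) (Fin n) ℂ}
    (hA : Function.Injective A.mulVec) : pinv A * A = 1 := by
  have hu : IsUnit (Aᴴ * A).det :=
    (Matrix.isUnit_iff_isUnit_det _).1 (Matrix.PosDef.conjTranspose_mul_self A hA).isUnit
  have hex : ∃ B, IsMoorePenroseInverse A B := by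
    have h1 : (Aᴴ * A)⁻¹ * Aᴴ * A = 1 := by
      rw [Matrix.mul_assoc, Matrix.nonsing_inv_mul _ hu]
    refine ⟨(Aᴴ * A)⁻¹ * Aᴴ, ?_, ?_, ?_, ?_⟩
    · rw [Matrix.mul_assoc, h1, Matrix.mul_one]
    · rw [h1, Matrix.one_mul]
    · simp only [Matrix.conjTranspose_mul, Matrix.conjTranspose_conjTranspose,
        Matrix.conjTranspose_nonsing_inv, Matrix.mul_assoc]
    · rw [h1, Matrix.conjTranspose_one]
  have hB : IsMoorePenroseInverse A (pinv A) := Classical.epsilon_spec hex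
  refine Matrix.ext_of_mulVec_single fun i => hA ?_
  rw [Matrix.mulVec_mulVec, ← Matrix.mul_assoc, hB.1, Matrix.one_mulVec]

/-- Vandermonde matrices with at least as many rows as nodes, and columns scaled by nonzero
factors, have independent columns. -/
theorem injective_mulVec_of_pow {m n : ℕ} (hmn : n ≤ m) {A : Matrix (Fin m) (Fin n) ℂ}
    {z γ : Fin n → ℂ} (hz : Function.Injective z) (hγ : ∀ i, γ i ≠ 0)
    (hA : ∀ k i, A k i = z i ^ (k : ℕ) * γ i) : Function.Injective A.mulVec := by
  refine (injective_iff_map_eq_zero A.mulVecLin).2 fun v hv => ?_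
  -- The scaling is absorbed into the vector, and the first `n` rows form a square Vandermonde
  -- system.
  have h0 : (fun i => γ i * v i) = 0 := by
    refine Matrix.eq_zero_of_forall_pow_sum_mul_pow_eq_zero hz fun k => ?_
    have h := congrFun hv (Fin.castLE hmn k)
    simp only [Matrix.mulVecLin_apply, Matrix.mulVec, dotProduct, hA, Pi.zero_apply,
      Fin.val_castLE] at h
    rw [← h]
    exact Finset.sum_congr rfl fun i _ => by ring
  ext i
  exact (mul_eq_zero.1 (congrFun h0 i)).resolve_left (hγ i)

/-- Compressing by `pinv V` on both sides recovers the invertible `P`, so no rank is lost. -/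
theorem rank_mul_posDef_mul_conjTranspose {m n : ℕ} {V : Matrix (Fin m) (Fin n) ℂ}
    (hV : Function.Injective V.mulVec) {P : Matrix (Fin n) (Fin n) ℂ} (hP : P.PosDef) :
    (V * P * Vᴴ).rank = n := by
  refine le_antisymm ?_ ?_
  · rw [Matrix.mul_assoc]
    exact (Matrix.rank_mul_le_left _ _).trans V.rank_le_width
  · have h1 : pinv V * (V * P * Vᴴ) * (pinv V)ᴴ = P := by
      have h2 : Vᴴ * (pinv V)ᴴ = 1 := by
        rw [← Matrix.conjTranspose_mul, pinv_mul_self hV, Matrix.conjTranspose_one]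
      rw [Matrix.mul_assoc, Matrix.mul_assoc (V * P), h2, Matrix.mul_one, ← Matrix.mul_assoc,
        pinv_mul_self hV, Matrix.one_mul]
    have h3 : P.rank = n := by
      rw [Matrix.rank_of_isUnit P hP.isUnit, Fintype.card_fin]
    calc n = (pinv V * (V * P * Vᴴ) * (pinv V)ᴴ).rank := by rw [h1, h3]
      _ ≤ (pinv V * (V * P * Vᴴ)).rank := Matrix.rank_mul_le_left _ _
      _ ≤ _ := Matrix.rank_mul_le_right _ _

theorem roots_prod_X_sub_C_univ {n : ℕ} (z : Fin n → ℂ) :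
    (∏ j, (Polynomial.X - Polynomial.C (z j))).roots = Finset.univ.val.map z := by
  have h := Polynomial.roots_multiset_prod_X_sub_C (Finset.univ.val.map z)
  rwa [Multiset.map_map] at h

/-- ESPRIT: the shift invariance of the column space of a Vandermonde matrix reveals its nodes. -/
theorem roots_charpoly_rotationMatrix {M r : ℕ} {z : Fin M → ℂ} (hz : Function.Injective z)
    {V : Matrix (Fin (M + 1)) (Fin M) ℂ} (hV : ∀ k i, V k i = z i ^ (k : ℕ))
    {P : Matrix (Fin M) (Fin M) ℂ} {E U : Matrix (Fin (M + 1)) (Fin r) ℂ} {σ : Fin r → ℝ}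
    (hr : r = M) (hE : IsCompactSVD (V * P * Vᴴ) E σ U) :
    (rotationMatrix E).charpoly.roots = Finset.univ.val.map z := by
  subst hr
  obtain ⟨hσ, hEE, hUU, hR⟩ := hE
  set D : Matrix (Fin r) (Fin r) ℂ := Matrix.diagonal fun i => (σ i : ℂ)
  set D' : Matrix (Fin r) (Fin r) ℂ := Matrix.diagonal fun i => ((σ i : ℂ))⁻¹
  have hDD : D * D' = 1 := by
    rw [Matrix.diagonal_mul_diagonal, ← Matrix.diagonal_one]
    congr 1
    ext i
    exact mul_inv_cancel₀ (by exact_mod_cast (hσ i).ne')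
  obtain ⟨Q, hQ⟩ : ∃ Q : Matrix (Fin r) (Fin r) ℂ, E = V * Q := by
    -- Solve `R = E D Uᴴ` for `E = R U D⁻¹` and insert `R = V P Vᴴ`.
    refine ⟨P * Vᴴ * U * D', ?_⟩
    calc E = E * D * (Uᴴ * U) * D' := by
          rw [hUU, Matrix.mul_one, Matrix.mul_assoc, hDD, Matrix.mul_one]
      _ = (E * D * Uᴴ) * U * D' := by simp only [Matrix.mul_assoc]
      _ = _ := by rw [← hR]; simp only [Matrix.mul_assoc]
  have hQ1 : (Eᴴ * V) * Q = 1 := by rw [Matrix.mul_assoc, ← hQ, hEE]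
  have hQ2 : Q * (Eᴴ * V) = 1 := mul_eq_one_comm.1 hQ1
  have hdown : E.submatrix Fin.castSucc id = V.submatrix Fin.castSucc id * Q := by
    rw [hQ]; rfl
  have hup : E.submatrix Fin.succ id =
      V.submatrix Fin.castSucc id * (Matrix.diagonal z * Q) := by
    rw [← Matrix.mul_assoc]
    have : V.submatrix Fin.succ id = V.submatrix Fin.castSucc id * Matrix.diagonal z := by
      ext k i
      rw [Matrix.mul_diagonal]
      simp [hV, pow_succ]
    rw [← this, hQ]
    rfl
  have hinj : Function.Injective (E.submatrix Fin.castSucc id).mulVec := by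
    have h1 : Function.Injective (V.submatrix Fin.castSucc id).mulVec :=
      injective_mulVec_of_pow le_rfl hz (γ := 1) (fun _ => one_ne_zero)
        (fun k i => by simp [hV])
    intro v w hvw
    simp only [hdown, ← Matrix.mulVec_mulVec] at hvw
    have h2 := congrArg (fun u => (Eᴴ * V) *ᵥ u) (h1 hvw)
    simpa only [Matrix.mulVec_mulVec, hQ1, Matrix.one_mulVec] using h2
  have hrot : rotationMatrix E = (Eᴴ * V) * (Matrix.diagonal z * Q) := by
    have h1 : E.submatrix Fin.succ id =
        E.submatrix Fin.castSucc id * ((Eᴴ * V) * (Matrix.diagonal z * Q)) := by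
      rw [hdown, hup, Matrix.mul_assoc, ← Matrix.mul_assoc Q, hQ2, Matrix.one_mul]
    rw [rotationMatrix, h1, ← Matrix.mul_assoc, pinv_mul_self hinj, Matrix.one_mul]
  -- `Eᴴ V` and `Q` are mutually inverse, so the rotation matrix is a conjugate of `diagonal z`.
  rw [hrot, Matrix.charpoly_mul_comm, Matrix.mul_assoc, hQ2, Matrix.mul_one,
    Matrix.charpoly_diagonal]
  exact roots_prod_X_sub_C_univ z

/-- For a positive semidefinite matrix, the spectral decomposition restricted to nonzero eigenvalues
is a compact SVD with equal left and right vectors; the rank counts these eigenvalues. -/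
theorem exists_isCompactSVD {m r : ℕ} {R : Matrix (Fin m) (Fin m) ℂ} (hR : R.PosSemidef)
    (hr : R.rank = r) :
    ∃ (E : Matrix (Fin m) (Fin r) ℂ) (σ : Fin r → ℝ), IsCompactSVD R E σ E := by
  have hH := hR.isHermitian
  have hcard : Fintype.card (Fin r) = Fintype.card {i // hH.eigenvalues i ≠ 0} := by
    rw [Fintype.card_fin, ← hr, hH.rank_eq_card_non_zero_eigs]
  let e : Fin r ≃ {i // hH.eigenvalues i ≠ 0} := Fintype.equivOfCardEq hcard
  obtain ⟨Q, hQQ, hspec⟩ : ∃ Q : Matrix (Fin m) (Fin m) ℂ, Qᴴ * Q = 1 ∧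
      R = Q * Matrix.diagonal (fun i => (hH.eigenvalues i : ℂ)) * Qᴴ :=
    ⟨hH.eigenvectorUnitary.1, Unitary.coe_star_mul_self hH.eigenvectorUnitary,
      hH.spectral_theorem⟩
  have hon : (Q.submatrix id fun j => (e j : Fin m))ᴴ * (Q.submatrix id fun j => (e j : Fin m))
      = 1 := by
    have : (Q.submatrix id fun j => (e j : Fin m))ᴴ * (Q.submatrix id fun j => (e j : Fin m)) =
        (Qᴴ * Q).submatrix (fun j => (e j : Fin m)) fun j => (e j : Fin m) := rfl
    rw [this, hQQ]
    exact Matrix.submatrix_one _ (Subtype.val_injective.comp e.injective)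
  refine ⟨Q.submatrix id fun j => (e j : Fin m), fun j => hH.eigenvalues (e j),
    fun j => (hR.eigenvalues_nonneg _).lt_of_ne' (e j).2, hon, hon, ?_⟩
  ext a b
  conv_lhs => rw [hspec]
  rw [Matrix.mul_apply, Matrix.mul_apply]
  simp only [Matrix.mul_diagonal, Matrix.submatrix_apply, id, Matrix.conjTranspose_apply]
  rw [e.sum_comp fun i : {i // hH.eigenvalues i ≠ 0} =>
    Q a i * (hH.eigenvalues i : ℂ) * star (Q b i),
    ← Finset.sum_subtype (Finset.univ.filter fun i => hH.eigenvalues i ≠ 0) (by simp)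
      fun i => Q a i * (hH.eigenvalues i : ℂ) * star (Q b i)]
  refine (Finset.sum_filter_of_ne (p := fun i => hH.eigenvalues i ≠ 0) fun i _ hi h0 => hi ?_).symm
  rw [h0]
  simp

theorem exists_isCompactSVD_mul_posDef {m n : ℕ} {V : Matrix (Fin m) (Fin n) ℂ}
    (hV : Function.Injective V.mulVec) {P : Matrix (Fin n) (Fin n) ℂ} (hP : P.PosDef) :
    ∃ (E : Matrix (Fin m) (Fin n) ℂ) (σ : Fin n → ℝ), IsCompactSVD (V * P * Vᴴ) E σ E :=
  exists_isCompactSVD (hP.posSemidef.mul_mul_conjTranspose_same V)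
    (rank_mul_posDef_mul_conjTranspose hV hP)

/-- Turns equality of root multisets into a relabelling; distinct values on one side force distinct
values on the other. -/
theorem exists_equiv_of_map_univ_eq {α : Type*} {m n : ℕ} {f : Fin m → α} {g : Fin n → α}
    (hg : Function.Injective g) (h : Finset.univ.val.map f = Finset.univ.val.map g) :
    ∃ e : Fin m ≃ Fin n, ∀ i, f i = g (e i) := by
  have hf : Function.Injective f := by
    rw [← Fintype.nodup_map_univ_iff_injective, h]
    exact Fintype.nodup_map_univ_iff_injective.2 hg
  have hmem : ∀ i, ∃ j, f i = g j := by
    intro i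
    have h1 : f i ∈ Finset.univ.val.map f := Multiset.mem_map_of_mem f (Finset.mem_univ i)
    rw [h] at h1
    obtain ⟨j, -, hj⟩ := Multiset.mem_map.1 h1
    exact ⟨j, hj.symm⟩
  choose e he using hmem
  have hcard : m = n := by simpa using congrArg Multiset.card h
  have hinj : Function.Injective e := fun i j hij => hf (by rw [he, he, hij])
  refine ⟨Equiv.ofBijective e ((Fintype.bijective_iff_injective_and_card e).2
    ⟨hinj, by simp [hcard]⟩), he⟩

end LinearAlgebra

/-! ### Annihilating filters of sums of exponentials -/

section Annihilating

variable {N K : ℕ} {z α : Fin K → ℂ} {u : ℕ → ℂ}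

/-- A filter acts on the exponential `z_j ^ n` as multiplication by `h(z_j)`. -/
theorem sum_coeff_mul_eq_sum_eval (hu : ∀ n < N, u n = ∑ j, α j * z j ^ n) (h : ℂ[X]) {n : ℕ}
    (hn : n + h.natDegree < N) :
    ∑ k ∈ Finset.range (h.natDegree + 1), h.coeff k * u (n + k) =
      ∑ j, α j * h.eval (z j) * z j ^ n := by
  have h1 : ∀ k ∈ Finset.range (h.natDegree + 1), h.coeff k * u (n + k) =
      ∑ j, α j * (h.coeff k * z j ^ k) * z j ^ n := by
    intro k hk
    have := Finset.mem_range.1 hk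
    rw [hu (n + k) (by omega), Finset.mul_sum]
    exact Finset.sum_congr rfl fun j _ => by ring
  rw [Finset.sum_congr rfl h1, Finset.sum_comm]
  refine Finset.sum_congr rfl fun j _ => ?_
  rw [← Finset.sum_mul, ← Finset.mul_sum, Polynomial.eval_eq_sum_range]

theorem natDegree_prod_X_sub_C_univ (z : Fin K → ℂ) :
    (∏ j, (Polynomial.X - Polynomial.C (z j))).natDegree = K := by
  rw [Polynomial.natDegree_prod_of_monic _ _ fun j _ => Polynomial.monic_X_sub_C _]
  simp

theorem isAnnihilatingFilter_prod (hu : ∀ n < N, u n = ∑ j, α j * z j ^ n) :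
    IsAnnihilatingFilter N u (∏ j, (Polynomial.X - Polynomial.C (z j))) := by
  refine ⟨Polynomial.monic_prod_of_monic _ _ fun j _ => Polynomial.monic_X_sub_C _,
    fun n hn => ?_⟩
  rw [sum_coeff_mul_eq_sum_eval hu _ hn]
  refine Finset.sum_eq_zero fun j _ => ?_
  rw [Polynomial.eval_prod, Finset.prod_eq_zero (Finset.mem_univ j) (by simp)]
  simp

/-- A sum of `K` exponentials observed at `2K` or more instants has no annihilating filter of
order at most `K` other than the one whose roots are the exponentials. -/
theorem IsAnnihilatingFilter.eq_prod (hz : Function.Injective z) (hα : ∀ j, α j ≠ 0)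
    (hN : 2 * K ≤ N) (hu : ∀ n < N, u n = ∑ j, α j * z j ^ n) {h : ℂ[X]}
    (hh : IsAnnihilatingFilter N u h) (hdeg : h.natDegree ≤ K) :
    h = ∏ j, (Polynomial.X - Polynomial.C (z j)) := by
  have h0 : (fun j => α j * h.eval (z j)) = 0 := by
    refine Matrix.eq_zero_of_forall_pow_sum_mul_pow_eq_zero hz fun n => ?_
    -- Here `2K ≤ N` enters: with order at most `K` there are at least `K` complete windows, enough
    -- for a square Vandermonde system in the `α_j h(z_j)`.
    have hn : (n : ℕ) + h.natDegree < N := by have := n.2; omega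
    rw [← hh.2 n hn, sum_coeff_mul_eq_sum_eval hu _ hn]
  have hroot : ∀ j, h.eval (z j) = 0 := fun j =>
    (mul_eq_zero.1 (congrFun h0 j)).resolve_left (hα j)
  have hdvd : (∏ j, (Polynomial.X - Polynomial.C (z j))) ∣ h :=
    Finset.prod_dvd_of_coprime (fun i _ j _ hij => Polynomial.isCoprime_X_sub_C_of_isUnit_sub
      (sub_ne_zero.2 (hz.ne hij)).isUnit) fun j _ => Polynomial.dvd_iff_isRoot.2 (hroot j)
  refine (Polynomial.eq_of_monic_of_dvd_of_natDegree_le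
    (Polynomial.monic_prod_of_monic _ _ fun j _ => Polynomial.monic_X_sub_C _) hh.1 hdvd ?_)
  rwa [natDegree_prod_X_sub_C_univ]

theorem IsMinimalAnnihilatingFilter.eq_prod (hz : Function.Injective z) (hα : ∀ j, α j ≠ 0)
    (hN : 2 * K ≤ N) (hu : ∀ n < N, u n = ∑ j, α j * z j ^ n) {h : ℂ[X]}
    (hh : IsMinimalAnnihilatingFilter N u h) :
    h = ∏ j, (Polynomial.X - Polynomial.C (z j)) :=
  hh.1.eq_prod hz hα hN hu
    ((hh.2 _ (isAnnihilatingFilter_prod hu)).trans_eq (natDegree_prod_X_sub_C_univ z))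

theorem isMinimalAnnihilatingFilter_prod (hz : Function.Injective z) (hα : ∀ j, α j ≠ 0)
    (hN : 2 * K ≤ N) (hu : ∀ n < N, u n = ∑ j, α j * z j ^ n) :
    IsMinimalAnnihilatingFilter N u (∏ j, (Polynomial.X - Polynomial.C (z j))) := by
  refine ⟨isAnnihilatingFilter_prod hu, fun h hh => ?_⟩
  rw [natDegree_prod_X_sub_C_univ]
  by_contra hlt
  have := hh.eq_prod hz hα hN hu (by omega)
  rw [this, natDegree_prod_X_sub_C_univ] at hlt
  exact hlt le_rfl

end Annihilating

/-! ### Reading delays and Doppler shifts off their nodes -/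

section Phases

/-- The node `e^{-j2πτ/T}` of a delay. -/
noncomputable def delayNode (T τ : ℝ) : ℂ :=
  Complex.exp (((-(2 * Real.pi * τ / T) : ℝ) : ℂ) * Complex.I)

/-- The node `e^{j2πνT}` of a Doppler shift. -/
noncomputable def dopplerNode (T ν : ℝ) : ℂ :=
  Complex.exp (((2 * Real.pi * ν * T : ℝ) : ℂ) * Complex.I)

theorem delay_of_arg_delayNode {T τ : ℝ} (hT : 0 < T) (h0 : 0 ≤ τ) (h1 : τ < T) :
    T * Int.fract (-(delayNode T τ).arg / (2 * Real.pi)) = τ := by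
  rw [delayNode, Complex.arg_exp_mul_I, toIocMod]
  have hpi := Real.pi_pos
  -- Changing the branch of the argument changes `τ/T` by an integer, which the fractional part
  -- removes.
  have h : ∀ k : ℤ, -(-(2 * Real.pi * τ / T) - k • (2 * Real.pi)) / (2 * Real.pi) =
      τ / T + k := by
    intro k
    rw [zsmul_eq_mul]
    field_simp
    ring
  rw [h, Int.fract_add_intCast, Int.fract_eq_self.2 ⟨by positivity, (div_lt_one hT).2 h1⟩]
  field_simp

theorem doppler_of_arg_dopplerNode {T ν : ℝ} (hT : 0 < T) (h : |ν| * T < 1 / 2) :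
    (dopplerNode T ν).arg / (2 * Real.pi * T) = ν := by
  have hpi := Real.pi_pos
  have h2 : |ν * T| < 1 / 2 := by rwa [abs_mul, abs_of_pos hT]
  rw [abs_lt] at h2
  -- `|2πνT| < π` already lies in the principal branch.
  rw [dopplerNode, Complex.arg_exp_mul_I, (toIocMod_eq_self Real.two_pi_pos).2]
  · field_simp
  · constructor <;> nlinarith

theorem dopplerMatrix_apply (T : ℝ) (N : ℕ) {K : ℕ} (ν : Fin K → ℝ) (n : Fin N) (j : Fin K) :
    dopplerMatrix T N ν n j = dopplerNode T (ν j) ^ (n : ℕ) := by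
  rw [dopplerMatrix, dopplerNode, Matrix.of_apply, ← Complex.exp_nat_mul]
  congr 1
  push_cast
  ring

/-- The centring `m' = m - M` costs only a nonzero factor per column. -/
theorem delayMatrix_eq_pow {T : ℝ} (M : ℕ) {r : ℕ} (τ : Fin r → ℝ)
    (m : Fin (2 * M)) (i : Fin r) :
    delayMatrix T M τ m i = delayNode T (τ i) ^ (m : ℕ) *
      Complex.exp (((2 * Real.pi * τ i / T * M : ℝ) : ℂ) * Complex.I) := by
  rw [delayMatrix_apply, delayNode, ← Complex.exp_nat_mul, ← Complex.exp_add]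
  congr 1
  push_cast
  ring

end Phases

/-! ### The smoothed correlation matrix -/

section Correlation

open scoped ComplexOrder

theorem mul_sum_sum_sum_eq {ι κ : Type*} [Fintype ι] [Fintype κ] (c : ℂ) (v u : ι → ℂ)
    (G : κ → ι → ι → ℂ) :
    c * ∑ m, ∑ i, ∑ j, v i * u j * G m i j = ∑ i, v i * ∑ j, (c * ∑ m, G m i j) * u j := by
  simp only [Finset.mul_sum, Finset.sum_mul]
  rw [Finset.sum_comm]
  refine Finset.sum_congr rfl fun i _ => ?_
  rw [Finset.sum_comm]
  exact Finset.sum_congr rfl fun j _ => Finset.sum_congr rfl fun m _ => by ring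

/-- The smoothed correlation matrix of `M` superposed sequences factors through the Vandermonde
matrix of the delays, with a positive definite middle factor: smoothing restores full rank. -/
theorem smoothedCorrelation_factor {M : ℕ} (hM : 0 < M) {z γ : Fin M → ℂ}
    (hz : Function.Injective z) (hγ : ∀ i, γ i ≠ 0) {b : Fin M → ℤ → ℂ}
    (hb : ∀ i, ∃ n, b i n ≠ 0)
    (hs : ∀ i j, Summable fun n => b i n * (starRingEnd ℂ) (b j n))
    {d : Fin (2 * M) → ℤ → ℂ}
    (hd : ∀ m n, d m n = ∑ i, z i ^ (m : ℕ) * γ i * b i n)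
    {V : Matrix (Fin (M + 1)) (Fin M) ℂ} (hV : ∀ k i, V k i = z i ^ (k : ℕ)) :
    ∃ P : Matrix (Fin M) (Fin M) ℂ, P.PosDef ∧ smoothedCorrelation M d = V * P * Vᴴ := by
  let w : Fin M → Fin M → ℤ → ℂ := fun m i n => z i ^ (m : ℕ) * γ i * b i n
  have hw : ∀ m i j, Summable fun n => w m i n * (starRingEnd ℂ) (w m j n) := by
    intro m i j
    refine ((hs i j).mul_left (z i ^ (m : ℕ) * γ i *
      (starRingEnd ℂ) (z j ^ (m : ℕ) * γ j))).congr fun n => ?_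
    simp only [w, map_mul]
    ring
  let G : Fin M → Fin M → Fin M → ℂ := fun m i j => ∑' n, w m i n * (starRingEnd ℂ) (w m j n)
  have hG : ∀ m i j, HasSum (fun n => w m i n * (starRingEnd ℂ) (w m j n)) (G m i j) :=
    fun m i j => (hw m i j).hasSum
  have hcomb : ∀ (m : Fin M) (v v' : Fin M → ℂ), HasSum (fun n =>
      (∑ i, v i * w m i n) * (starRingEnd ℂ) (∑ j, v' j * w m j n))
      (∑ i, ∑ j, v i * (starRingEnd ℂ) (v' j) * G m i j) := by
    intro m v v'
    have hterm : (fun n => (∑ i, v i * w m i n) * (starRingEnd ℂ) (∑ j, v' j * w m j n)) =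
        fun n => ∑ i, ∑ j, v i * (starRingEnd ℂ) (v' j) *
          (w m i n * (starRingEnd ℂ) (w m j n)) := by
      ext n
      rw [map_sum, Finset.sum_mul_sum]
      refine Finset.sum_congr rfl fun i _ => Finset.sum_congr rfl fun j _ => ?_
      rw [map_mul]
      ring
    rw [hterm]
    exact hasSum_sum fun i _ => hasSum_sum fun j _ => (hG m i j).mul_left _
  refine ⟨Matrix.of fun i j => (1 / M : ℂ) * ∑ m, G m i j, ?_, ?_⟩
  · refine Matrix.PosDef.of_dotProduct_mulVec_pos ?_ ?_
    · ext i j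
      simp only [Matrix.conjTranspose_apply, Matrix.of_apply, G, star_mul', star_sum]
      congr 1
      · simp
      · refine Finset.sum_congr rfl fun m _ => ?_
        rw [tsum_star]
        refine tsum_congr fun n => ?_
        simp [mul_comm]
    · intro v hv
      -- `P` is an average of Gram matrices, so its quadratic form is a sum of squared norms over
      -- all shifts `m` and times `n`.
      have hquad : star v ⬝ᵥ (Matrix.of fun i j => (1 / M : ℂ) * ∑ m, G m i j) *ᵥ v =
          ((1 / M * ∑ m, ∑' n, ‖∑ i, star (v i) * w m i n‖ ^ 2 : ℝ) : ℂ) := by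
        have h1 : ∀ m, ((∑' n, ‖∑ i, star (v i) * w m i n‖ ^ 2 : ℝ) : ℂ) =
            ∑ i, ∑ j, star (v i) * v j * G m i j := by
          intro m
          rw [Complex.ofReal_tsum]
          have h := (hcomb m (star v) (star v)).tsum_eq
          simp only [Complex.mul_conj', Pi.star_apply, RCLike.star_def, Complex.conj_conj] at h
          simp only [RCLike.star_def]
          rw [← h]
          simp
        rw [Complex.ofReal_mul, Complex.ofReal_sum, Finset.sum_congr rfl fun m _ => h1 m,
          mul_sum_sum_sum_eq]
        push_cast
        rfl
      rw [hquad]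
      have hsum : ∀ m, Summable fun n => ‖∑ i, star (v i) * w m i n‖ ^ 2 := by
        intro m
        have h := (hcomb m (star v) (star v)).summable
        simp only [Complex.mul_conj', Pi.star_apply] at h
        exact_mod_cast h
      have hnn : ∀ m, 0 ≤ ∑' n, ‖∑ i, star (v i) * w m i n‖ ^ 2 :=
        fun m => tsum_nonneg fun n => by positivity
      have hpos : 0 < ∑ m, ∑' n, ‖∑ i, star (v i) * w m i n‖ ^ 2 := by
        refine (Finset.sum_nonneg fun m _ => hnn m).lt_of_ne' fun h0 => hv ?_
        have h1 := (Finset.sum_eq_zero_iff_of_nonneg fun m _ => hnn m).1 h0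
        have h2 : ∀ m n, ∑ i, star (v i) * w m i n = 0 := by
          intro m n
          have h3 := h1 m (Finset.mem_univ m)
          have h4 := congrFun ((hasSum_zero_iff_of_nonneg fun n => by positivity).1
            (h3 ▸ (hsum m).hasSum)) n
          simpa using h4
        ext i
        obtain ⟨n, hn⟩ := hb i
        -- At a time `n` with `b i n ≠ 0`, the `M` shifts give a square Vandermonde system. Thus no
        -- linear independence of the sequences `b_i` has to be assumed.
        have h4 : (fun i => star (v i) * γ i * b i n) = 0 := by
          refine Matrix.eq_zero_of_forall_pow_sum_mul_pow_eq_zero hz fun m => ?_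
          rw [← h2 m n]
          exact Finset.sum_congr rfl fun i _ => by simp only [w]; ring
        have h5 := congrFun h4 i
        simpa [hγ i, hn] using h5
      have hM' : (0 : ℝ) < M := by exact_mod_cast hM
      exact_mod_cast mul_pos (one_div_pos.2 hM') hpos
  · ext k l
    have h1 : ∀ m : Fin M, ∑' n, d ⟨m + k, by omega⟩ n * (starRingEnd ℂ) (d ⟨m + l, by omega⟩ n) =
        ∑ i, ∑ j, V k i * (starRingEnd ℂ) (V l j) * G m i j := by
      intro m
      rw [← (hcomb m (V k) (V l)).tsum_eq]
      refine tsum_congr fun n => ?_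
      have h2 : ∀ k : Fin (M + 1), d ⟨m + k, by omega⟩ n = ∑ i, V k i * w m i n := by
        intro k
        rw [hd]
        refine Finset.sum_congr rfl fun i _ => ?_
        simp only [hV, w, pow_add]
        ring
      rw [h2, h2]
    rw [smoothedCorrelation, Matrix.of_apply, Finset.sum_congr rfl fun m _ => h1 m,
      mul_sum_sum_sum_eq, Matrix.mul_assoc]
    rfl

end Correlation

/-! ### Recovery of coefficients and gains for any ordering -/

theorem delayNode_injective_comp {T : ℝ} (hT : 0 < T) {K : ℕ} {τ : Fin K → ℝ}
    (hτ : ∀ i, 0 ≤ τ i ∧ τ i < T) (hinj : Function.Injective τ) :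
    Function.Injective fun i => delayNode T (τ i) := by
  intro i j hij
  apply hinj
  rw [← delay_of_arg_delayNode hT (hτ i).1 (hτ i).2,
    ← delay_of_arg_delayNode hT (hτ j).1 (hτ j).2]
  simp only at hij
  rw [hij]

theorem dopplerNode_injective_comp {T : ℝ} (hT : 0 < T) {K : ℕ} {ν : Fin K → ℝ}
    (hν : ∀ j, |ν j| * T < 1 / 2) (hinj : Function.Injective ν) :
    Function.Injective fun j => dopplerNode T (ν j) := by
  intro i j hij
  apply hinj
  rw [← doppler_of_arg_dopplerNode hT (hν i), ← doppler_of_arg_dopplerNode hT (hν j)]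
  simp only at hij
  rw [hij]

theorem dopplerMatrix_mulVec_injective {T : ℝ} {N K : ℕ} (hKN : K ≤ N) {ν : Fin K → ℝ}
    (hν : Function.Injective fun j => dopplerNode T (ν j)) :
    Function.Injective (dopplerMatrix T N ν).mulVec :=
  injective_mulVec_of_pow hKN hν (γ := 1) (fun _ => one_ne_zero)
    fun n j => by rw [dopplerMatrix_apply, Pi.one_apply, mul_one]

theorem delayMatrix_mulVec_injective {T : ℝ} {M r : ℕ} (hr : r ≤ 2 * M) {τ : Fin r → ℝ}
    (hτ : Function.Injective fun i => delayNode T (τ i)) :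
    Function.Injective (delayMatrix T M τ).mulVec :=
  injective_mulVec_of_pow hr hτ (fun _ => Complex.exp_ne_zero _) (delayMatrix_eq_pow M τ)

namespace DelayDoppler

variable {H : DelayDoppler} {T : ℝ} {N : ℕ} {x : ℕ → ℂ}

theorem coeffSeq_div (hx : ∀ n < N, 0 < ‖x n‖) (i : Fin H.numDelays) {n : ℕ} (hn : n < N) :
    H.coeffSeq T x i n / x n = ∑ j, H.gain i j * dopplerNode T (H.doppler i j) ^ n := by
  rw [coeffSeq, Finset.sum_div]
  refine Finset.sum_congr rfl fun j _ => ?_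
  rw [mul_right_comm, mul_div_assoc, div_self (norm_pos_iff.1 (hx n hn)), mul_one, dopplerNode,
    ← Complex.exp_nat_mul]
  congr 2
  push_cast
  ring

/-- If `b_i` vanished, so would its advance `a_i`; a combination of distinct exponentials vanishing
at `K_{ν,i}` successive instants has only zero gains. -/
theorem exists_echoSeq_ne_zero (hH : H.IsParametricSystem) (hT : 0 < T)
    (hx : ∀ n < N, 0 < ‖x n‖) {i : Fin H.numDelays} (hN : H.numDopplers i ≤ N)
    (hz : Function.Injective fun j => dopplerNode T (H.doppler i j)) :
    ∃ n, H.echoSeq T N x i n ≠ 0 := by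
  by_contra! h0
  have h1 : H.gain i = 0 := by
    refine Matrix.eq_zero_of_forall_pow_sum_mul_pow_eq_zero hz fun n => ?_
    have hn : (n : ℕ) < N := n.2.trans_le hN
    have h2 := H.seqConv_echoSeq hT N x i n
    rw [if_pos hn] at h2
    rw [← coeffSeq_div hx i hn, ← h2, seqConv]
    simp [h0]
  exact hH.gain_ne_zero i ⟨0, hH.numDopplers_pos i⟩ (congrFun h1 _)

theorem recoveredSeq_eq_coeffSeq (hT : 0 < T) {M : ℕ} {d : Fin (2 * M) → ℤ → ℂ}
    (hd : ∀ m n, d m n = ∑ i, delayMatrix T M H.delay m i * H.echoSeq T N x i n) {r : ℕ}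
    (hr : r ≤ 2 * M) {τ : Fin r → ℝ} (hτ : Function.Injective fun i => delayNode T (τ i))
    (e : Fin r ≃ Fin H.numDelays) (hτe : ∀ i, τ i = H.delay (e i)) (i : Fin r) {n : ℕ}
    (hn : n < N) : recoveredSeq T M d τ i n = H.coeffSeq T x (e i) n := by
  have hpinv : ∀ k : ℤ, (pinv (delayMatrix T M τ) *ᵥ fun m => d m k) =
      fun i => H.echoSeq T N x (e i) k := by
    intro k
    have h1 : (fun m => d m k) =
        delayMatrix T M τ *ᵥ fun i => H.echoSeq T N x (e i) k := by
      ext m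
      rw [hd, Matrix.mulVec, dotProduct, ← e.sum_comp]
      refine Finset.sum_congr rfl fun i _ => ?_
      simp only [delayMatrix, Matrix.of_apply, hτe]
    rw [h1, Matrix.mulVec_mulVec, pinv_mul_self (delayMatrix_mulVec_injective hr hτ),
      Matrix.one_mulVec]
  have h2 := H.seqConv_echoSeq hT N x (e i) n
  rw [if_pos hn] at h2
  rw [recoveredSeq, ← h2, hτe]
  simp only [hpinv]

theorem pinv_dopplerMatrix_mulVec {i : Fin H.numDelays} (hN : H.numDopplers i ≤ N)
    (hz : Function.Injective fun j => dopplerNode T (H.doppler i j)) {K : ℕ} {ν : Fin K → ℝ}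
    (f : Fin K ≃ Fin (H.numDopplers i)) (hν : ∀ j, ν j = H.doppler i (f j))
    {u : Fin N → ℂ}
    (hu : ∀ n, u n = ∑ j, H.gain i j * dopplerNode T (H.doppler i j) ^ (n : ℕ)) :
    pinv (dopplerMatrix T N ν) *ᵥ u = fun j => H.gain i (f j) := by
  have h1 : u = dopplerMatrix T N ν *ᵥ fun j => H.gain i (f j) := by
    ext n
    rw [hu, Matrix.mulVec, dotProduct, ← f.sum_comp]
    refine Finset.sum_congr rfl fun j _ => ?_
    rw [dopplerMatrix_apply, hν, mul_comm]
  have hK : K ≤ N := by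
    have : K = H.numDopplers i := by simpa using Fintype.card_congr f
    omega
  have hinj : Function.Injective fun j => dopplerNode T (ν j) := by
    simp only [hν]
    exact hz.comp f.injective
  rw [h1, Matrix.mulVec_mulVec, pinv_mul_self (dopplerMatrix_mulVec_injective hK hinj),
    Matrix.one_mulVec]

end DelayDoppler

/-! ### Assembling the identification theorem -/

theorem theorem2
    (H : DelayDoppler) (hH : H.IsParametricSystem)
    -- bandwidth and temporal support of the input signal, delay spread and Doppler spread
    (W TS τmax νmax : ℝ) (hW : 0 < W)
    -- the time-bandwidth condition
    (hTW : 8 * Real.pi * H.numDelays * H.maxDopplers ≤ TS * W)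
    -- the pulse period and the number of pulses
    (T : ℝ) (hT : T = 4 * Real.pi * H.numDelays / W)
    (N : ℕ) (hN : N = ⌊TS / T⌋₊)
    -- the pulse of unit energy, the kernel of the low-pass filter and the probing sequence
    (g s : Lp ℂ 2 (volume : Measure ℝ)) (hg_energy : ‖g‖ = 1)
    (hg : FillsBand W g) (hs : FillsBand W s)
    (x : ℕ → ℂ) (hx : ∀ n < N, 0 < ‖x n‖)
    -- the assumptions [A1], [A2], [A3]
    (hA1 : H.LiesIn τmax νmax) (hA2 : τmax < T) (hA3 : νmax * T < 1)
    -- the observation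
    (y : ℝ → ℂ) (hy : y =ᵐ[volume] H.output T N x g) :
    Nonempty (RecoveryRun W T H.numDelays N g s x y) ∧
      ∀ run : RecoveryRun W T H.numDelays N g s x y, run.estimate.SameTriplets H := by
  have hK : 0 < H.numDelays := hH.numDelays_pos
  have hKr : (0 : ℝ) < H.numDelays := by exact_mod_cast hK
  have hpi := Real.pi_pos
  have hT0 : 0 < T := by rw [hT]; positivity
  have hWT : W = 4 * Real.pi * H.numDelays / T := by rw [hT]; field_simp
  -- `TS / T = TS · W / (4πK_τ) ≥ 2K_{ν,max}`. As `2K_{ν,max} ≠ 0`, the bound on the natural floor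
  -- needs no sign condition on `TS`.
  have hmaxN : 2 * H.maxDopplers ≤ N := by
    rw [hN, Nat.le_floor_iff' (by
      have := (hH.numDopplers_pos ⟨0, hK⟩).trans_le
        (Finset.le_sup (f := H.numDopplers) (Finset.mem_univ (⟨0, hK⟩ : Fin H.numDelays)))
      rw [DelayDoppler.maxDopplers]
      omega), hT, le_div_iff₀ (by positivity)]
    push_cast
    rw [mul_div_assoc', div_le_iff₀ hW]
    linarith
  have hDN : ∀ i, 2 * H.numDopplers i ≤ N := fun i =>
    (Nat.mul_le_mul_left 2 (Finset.le_sup (f := H.numDopplers) (Finset.mem_univ i))).trans hmaxN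
  have hDN' : ∀ i, H.numDopplers i ≤ N := fun i => by have := hDN i; omega
  have hτ : ∀ i, 0 ≤ H.delay i ∧ H.delay i < T := fun i =>
    ⟨(hA1 i).1.1, (hA1 i).1.2.trans_lt hA2⟩
  have hν : ∀ i j, |H.doppler i j| * T < 1 / 2 := by
    intro i j
    have h1 : |H.doppler i j| ≤ νmax / 2 := by
      have := (hA1 i).2 j
      exact abs_le.2 ⟨by linarith [this.1], this.2⟩
    nlinarith
  have hτinj := delayNode_injective_comp hT0 hτ hH.delay_injective
  have hνinj := fun i => dopplerNode_injective_comp hT0 (hν i) (hH.doppler_injective i)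
  set d := modifiedSeq W T H.numDelays g s y with hd_def
  have hd : ∀ m n, d m n =
      ∑ i, delayMatrix T H.numDelays H.delay m i * H.echoSeq T N x i n :=
    H.modifiedSeq_eq_sum hT0 hK hWT hg hs hy
  let V : Matrix (Fin (H.numDelays + 1)) (Fin H.numDelays) ℂ :=
    Matrix.of fun k i => delayNode T (H.delay i) ^ (k : ℕ)
  obtain ⟨P, hP, hR⟩ := smoothedCorrelation_factor (V := V) hK hτinj
    (fun i => Complex.exp_ne_zero (((2 * Real.pi * H.delay i / T * H.numDelays : ℝ) : ℂ) *
      Complex.I))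
    (fun i => DelayDoppler.exists_echoSeq_ne_zero hH hT0 hx (hDN' i) (hνinj i))
    (H.summable_echoSeq_mul_conj hT0 N x) (d := d)
    (fun m n => by simp only [hd, delayMatrix_eq_pow]) (fun k i => rfl)
  have hVinj : Function.Injective V.mulVec :=
    injective_mulVec_of_pow (Nat.le_succ _) hτinj (γ := 1) (fun _ => one_ne_zero)
      fun k i => by simp [V]
  have hrank : (smoothedCorrelation H.numDelays d).rank = H.numDelays := by
    rw [hR]
    exact rank_mul_posDef_mul_conjTranspose hVinj hP
  -- Stated for an arbitrary relabelling: the identity serves existence, the order chosen by a run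
  -- serves uniqueness.
  have hrec : ∀ {r : ℕ} {τ : Fin r → ℝ} (e : Fin r ≃ Fin H.numDelays),
      (∀ i, τ i = H.delay (e i)) → ∀ i, ∀ n < N,
      recoveredSeq T H.numDelays d τ i n / x n =
        ∑ j, H.gain (e i) j * dopplerNode T (H.doppler (e i) j) ^ n := by
    intro r τ e hτe i n hn
    have hr : r = H.numDelays := by simpa using Fintype.card_congr e
    rw [DelayDoppler.recoveredSeq_eq_coeffSeq hT0 hd (by omega) ?_ e hτe i hn,
      DelayDoppler.coeffSeq_div hx _ hn]
    simp only [hτe]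
    exact hτinj.comp e.injective
  refine ⟨?_, fun run => ?_⟩
  · obtain ⟨E, σ, hE⟩ := exists_isCompactSVD_mul_posDef hVinj hP
    have hrec' := hrec (τ := H.delay) (Equiv.refl _) fun _ => rfl
    exact ⟨{
      estimate := H
      numDelays_eq := hrank.symm
      leftVec := E
      singularValue := σ
      rightVec := E
      svd := hR ▸ hE
      eigenvalue := fun i => delayNode T (H.delay i)
      eigenvalue_eq := roots_charpoly_rotationMatrix hτinj (fun k i => rfl) rfl hE
      delay_eq := fun i => (delay_of_arg_delayNode hT0 (hτ i).1 (hτ i).2).symm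
      filter := fun i => ∏ j, (Polynomial.X - Polynomial.C (dopplerNode T (H.doppler i j)))
      filter_minimal := fun i => isMinimalAnnihilatingFilter_prod (hνinj i) (hH.gain_ne_zero i)
        (hDN i) (hrec' i)
      root := fun i j => dopplerNode T (H.doppler i j)
      root_eq := fun i => roots_prod_X_sub_C_univ _
      doppler_eq := fun i j => (doppler_of_arg_dopplerNode hT0 (hν i j)).symm
      gain_eq := fun i => (DelayDoppler.pinv_dopplerMatrix_mulVec (hDN' i) (hνinj i)
        (Equiv.refl _) (fun _ => rfl) fun n => hrec' i n n.2).symm }⟩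
  · have hr : run.estimate.numDelays = H.numDelays := run.numDelays_eq.trans hrank
    have hsvd := run.svd
    rw [← hd_def, hR] at hsvd
    have hroots := roots_charpoly_rotationMatrix hτinj (fun k i => rfl) hr hsvd
    obtain ⟨e, he⟩ := exists_equiv_of_map_univ_eq hτinj (run.eigenvalue_eq.symm.trans hroots)
    have hdelay : ∀ i, run.estimate.delay i = H.delay (e i) := by
      intro i
      rw [run.delay_eq, he, delay_of_arg_delayNode hT0 (hτ _).1 (hτ _).2]
    refine ⟨e, hdelay, fun i => ?_⟩
    have hrec' := hrec e hdelay i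
    -- The order of the filter is not known beforehand; minimality against the true product bounds
    -- it by the number of Doppler shifts at this delay.
    have hfilter := (run.filter_minimal i).eq_prod (hνinj (e i)) (hH.gain_ne_zero (e i))
      (hDN (e i)) hrec'
    have hroot := run.root_eq i
    rw [hfilter, roots_prod_X_sub_C_univ] at hroot
    obtain ⟨f, hf⟩ := exists_equiv_of_map_univ_eq (hνinj (e i)) hroot.symm
    have hdop : ∀ j, run.estimate.doppler i j = H.doppler (e i) (f j) := by
      intro j
      rw [run.doppler_eq, hf, doppler_of_arg_dopplerNode hT0 (hν _ _)]
    refine ⟨f, fun j => ⟨hdop j, ?_⟩⟩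
    rw [run.gain_eq i, DelayDoppler.pinv_dopplerMatrix_mulVec (hDN' (e i)) (hνinj (e i)) f hdop
      fun n => hrec' n n.2]
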